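/- Let $\mathcal H$ be an infinite-dimensional separable real Hilbert space, write $(a\otimes b)\zeta=\langle a,\zeta\rangle b$, and let $\|\cdot\|_{op}$, $\|\cdot\|_{HS}$ be the operator and Hilbert–Schmidt norms. Let $x_t,y_t,z_t$ ($t\ge 1$) be random elements of $\mathcal H$, let $\mathcal A,\mathcal B$ be bounded linear operators on $\mathcal H$, and put $u_t=y_t-\mathcal A x_t$, $v_t=x_t-\mathcal B z_t$. For processes $a,b$ let $\widehat{\mathcal C}_{ab}=T^{-1}\sum_{t=1}^T a_t\otimes b_t$ and $\mathcal C_{ab}=\mathbb E[a_t\otimes b_t]$. Let $\mathcal C_{zz}=\sum_j\mu_j\,g_j\otimes g_j$ and $\mathcal Q=\mathcal C_{xz}^*\mathcal C_{zz}^{-1}\mathcal C_{xz}=\sum_j\nu_j\,h_j\otimes h_j$ be spectral decompositions with orthonormal bases $(g_j)$, $(h_j)$; here $\mathcal Q$ is the bounded operator $\sum_j\mu_j^{-1}(\mathcal C_{xz}^*g_j)\otimes(\mathcal C_{xz}^*g_j)$. **Basic assumptions.** (i) $(x_t,z_t)$ is strictly stationary and geometrically strongly mixing, $x_t,z_t$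 have mean zero, and $x_t,z_t,u_t$ are square integrable. (ii) With $\mathfrak F_{t-1}=\sigma(\{z_s\}_{s\le t},\{u_s\}_{s\le t-1})$: $\mathbb E[u_t\mid\mathfrak F_{t-1}]=0$, $\mathbb E[u_t\otimes u_t\mid\mathfrak F_{t-1}]=\mathcal C_{uu}$, and for some $\delta>0$, $\sup_{1\le t\le T}\mathbb E[\|u_t\|^{2+\delta}\mid\mathfrak F_{t-1}]<\infty$ almost surely for each $T$. (iii) $\mathbb E[z_t\otimes v_t]=0$. (iv) $\ker\mathcal Q=\{0\}$ and $\|\mathcal A\|_{HS}<\infty$. (v) $\mu_1>\mu_2>\dots>0$ and $\nu_1>\nu_2>\dots>0$. (vi) $\|\widehat{\mathcal C}_{xz}-\mathcal C_{xz}\|_{HS}$, $\|\widehat{\mathcal C}_{zz}-\mathcal C_{zz}\|_{HS}$, $\|\widehat{\mathcal C}_{uz}-\mathcal C_{uz}\|_{HS}$ and $\|\widehat{\mathcal C}_{vz}\|_{HS}$ are $O_p(T^{-1/2})$, and $\|\widehat{\mathcal C}_{uu}-\mathcal C_{uu}\|_{HS}=o_p(1)$. **Rate assumptions.** There are constants $c>0$,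 $\rho_\mu,\rho_\nu>2$, $\varsigma_\mu,\varsigma_\nu,\gamma_\mu,\gamma_\nu>1/2$ and $m>1$ such that for all $j,\ell\ge1$, all $t\ge 1$ and all lags $1\le s<t$: $\mu_j^2\le c\,j^{-\rho_\mu}$ and $\mu_j^2-\mu_{j+1}^2\ge c^{-1}j^{-\rho_\mu-1}$; $\nu_j^2\le c\,j^{-\rho_\nu}$ and $\nu_j^2-\nu_{j+1}^2\ge c^{-1}j^{-\rho_\nu-1}$; $|\langle h_j,\mathcal A h_\ell\rangle|\le c\,j^{-\gamma_\nu}\ell^{-\varsigma_\nu}$; $|\langle h_j,\mathcal B g_\ell\rangle|\le c\,j^{-\gamma_\mu}\ell^{-\varsigma_\mu}$; with $\tilde\upsilon_t(j,\ell)=\langle z_t,g_j\rangle\langle z_t,g_\ell\rangle-\mathbb E[\langle z_t,g_j\rangle\langle z_t,g_\ell\rangle]$, $\mathbb E[\tilde\upsilon_t(j,\ell)\tilde\upsilon_{t-s}(j,\ell)]\le c\,s^{-m}\,\mathbb E[\tilde\upsilon_t(j,\ell)^2]$; $\mathbb E\|\langle z_t,g_j\rangle z_t\|^2\le c\,\mu_j$;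 and $\mathbb E\|\langle x_t,h_j\rangle z_t\|^2\le c\,\nu_j$. **Estimator.** For an operator $\mathcal T$ with eigenelements ordered from the largest eigenvalue to the smallest, $\mathcal T_K^{-1}$ denotes the inverse restricted to the first $K$ eigenelements. Let $\widehat\mu_j$ be the ordered eigenvalues of $\widehat{\mathcal C}_{zz}$, $K_1=\#\{j:\widehat\mu_j^2>\alpha_1\}$, $\widehat{\mathcal P}=\widehat{\mathcal C}_{yz}^*(\widehat{\mathcal C}_{zz})_{K_1}^{-1}\widehat{\mathcal C}_{xz}$, $\widehat{\mathcal Q}=\widehat{\mathcal C}_{xz}^*(\widehat{\mathcal C}_{zz})_{K_1}^{-1}\widehat{\mathcal C}_{xz}$, let $(\widehat\nu_j,\widehat h_j)$ be the ordered eigenelements of $\widehat{\mathcal Q}$, $K_2=\#\{j:\widehat\nu_j^2>\alpha_2\}$, $\widetilde{\mathcal A}=\widehat{\mathcal P}\,\widehat{\mathcal Q}_{K_2}^{-1}$ (the F2SLSE) and $\widetilde\Pi_{K_2}=\sum_{j\le K_2}\widehat h_j\otimes\widehat h_j$. **Theorem.** Suppose that these assumptions hold and that the positive deterministic $\alpha_1=\alpha_1(T)\to0$,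 $\alpha_2=\alpha_2(T)\to0$ satisfy $\alpha_1^{-1}=o(T^{\rho_\mu/(2\rho_\mu+2)})$ and $\alpha_2^{-1}=o(\alpha_1^{-\rho_\nu/(2\rho_\nu+2)})$ as $T\to\infty$. Then $$\|\widetilde{\mathcal A}-\mathcal A\widetilde\Pi_{K_2}\|_{op}^2=O_p(T^{-1}\alpha_1^{-1/2}\alpha_2^{-1/2}),$$ $$\|\mathcal A(\mathcal I-\widetilde\Pi_{K_2})\|_{op}^2=O_p\big(\alpha_1\alpha_2^{-1}\max\{1,\alpha_2^{(2\varsigma_\nu-3)/\rho_\nu}\}+\alpha_2^{(2\varsigma_\nu-1)/\rho_\nu}\big),$$ and consequently $\|\widetilde{\mathcal A}-\mathcal A\|_{op}=o_p(1)$. -/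

import Mathlib

open MeasureTheory Filter Topology Asymptotics
open scoped ENNReal RealInnerProductSpace InnerProduct

noncomputable section

namespace FIV

variable {H : Type*} [NormedAddCommGroup H] [InnerProductSpace ℝ H]

/-! ### Operators on a real Hilbert space -/

/-- The tensor product of two vectors, `(a ⊗ b) ζ = ⟪a, ζ⟫ b`. -/
def tens (a b : H) : H →L[ℝ] H := (innerSL ℝ a).smulRight b

/-- The Hilbert-Schmidt norm `(∑ j, ‖S e_j‖ ^ 2) ^ (1/2)`; the sum has the same value for every
orthonormal basis `e`, so the supremum is over equal numbers. -/
def hsNorm (S : H →L[ℝ] H) : ℝ≥0∞ :=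
  (⨆ e : HilbertBasis ℕ ℝ H, ∑' j, ‖S (e j)‖ₑ ^ 2) ^ (1 / 2 : ℝ)

/-- `(lam j, e j)`, `j = 0, 1, …`, are the eigenelements of `S`: the eigenvalues are listed from
the largest to the smallest (with multiplicity), the eigenvectors form an orthonormal basis. -/
structure IsEigensystem (S : H →L[ℝ] H) (lam : ℕ → ℝ) (e : HilbertBasis ℕ ℝ H) : Prop where
  antitone : Antitone lam
  eigen : ∀ j, S (e j) = lam j • e j

/-- Regularized inverse based on the first `K` eigenelements, `∑_{j ≤ K} lam_j⁻¹ e_j ⊗ e_j`. -/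
def regInv (lam : ℕ → ℝ) (e : HilbertBasis ℕ ℝ H) (K : ℕ) : H →L[ℝ] H :=
  ∑ j ∈ Finset.range K, (lam j)⁻¹ • tens (e j) (e j)

/-- Orthogonal projection onto the span of the first `K` eigenvectors, `∑_{j ≤ K} e_j ⊗ e_j`. -/
def firstProj (e : HilbertBasis ℕ ℝ H) (K : ℕ) : H →L[ℝ] H :=
  ∑ j ∈ Finset.range K, tens (e j) (e j)

/-- `#{j : lam_j ^ 2 > α}`. -/
def truncCount (lam : ℕ → ℝ) (α : ℝ) : ℕ := Set.ncard {j : ℕ | α < lam j ^ 2}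

/-! ### Probabilistic notions -/

variable {Ω : Type*} [MeasurableSpace Ω]

/-- `X_T = O_p(r_T)` as `T → ∞`, for nonnegative `X_T`. -/
def IsBigOp (P : Measure Ω) (X : ℕ → Ω → ℝ≥0∞) (r : ℕ → ℝ) : Prop :=
  ∀ ε : ℝ, 0 < ε → ∃ M : ℝ, ∀ᶠ T in atTop,
    P {ω | ENNReal.ofReal (M * r T) < X T ω} ≤ ENNReal.ofReal ε

/-- `X_T = o_p(1)` as `T → ∞`, for nonnegative `X_T`. -/
def IsLittleOpOne (P : Measure Ω) (X : ℕ → Ω → ℝ≥0∞) : Prop :=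
  ∀ ε : ℝ, 0 < ε → Tendsto (fun T => P {ω | ENNReal.ofReal ε < X T ω}) atTop (𝓝 0)

/-- Strict stationarity: the law of the whole sequence is invariant under time shifts. -/
def IsStationarySeq {E : Type*} [MeasurableSpace E] (P : Measure Ω) (w : ℕ → Ω → E) : Prop :=
  ∀ s : ℕ, P.map (fun ω t => w (t + s) ω) = P.map (fun ω t => w t ω)

/-- Geometric strong mixing: the strong mixing coefficients between `σ(w_s, s ≤ t)` and
`σ(w_s, s ≥ t + k)` are bounded by `C r ^ k` for some `r < 1`, uniformly in `t`. -/
def IsGeomStrongMixing {E : Type*} [MeasurableSpace E] (P : Measure Ω) (w : ℕ → Ω → E) : Prop :=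
  ∃ C r : ℝ, 0 ≤ r ∧ r < 1 ∧ ∀ (t k : ℕ) (S U : Set Ω),
    MeasurableSet[⨆ s ∈ Set.Iic t, MeasurableSpace.comap (w s) inferInstance] S →
    MeasurableSet[⨆ s ∈ Set.Ici (t + k), MeasurableSpace.comap (w s) inferInstance] U →
    |P.real (S ∩ U) - P.real S * P.real U| ≤ C * r ^ k

/-- `E[a ⊗ b]`. -/
def momentOp (P : Measure Ω) (a b : Ω → H) : H →L[ℝ] H := ∫ ω, tens (a ω) (b ω) ∂P

/-- `T⁻¹ ∑_t a_t ⊗ b_t`; the `T` observations are those with index `0, …, T - 1`. -/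
def sampleOp (a b : ℕ → Ω → H) (T : ℕ) (ω : Ω) : H →L[ℝ] H :=
  (T : ℝ)⁻¹ • ∑ t ∈ Finset.range T, tens (a t ω) (b t ω)

/-- The error `b_t - S a_t` of the linear model `b_t = S a_t + error`. -/
def resid (S : H →L[ℝ] H) (a b : ℕ → Ω → H) (t : ℕ) (ω : Ω) : H := b t ω - S (a t ω)

/-- The information preceding `u_t`: the σ-field generated by `z_s`, `s ≤ t`, and `u_s`,
`s < t`. -/
@[reducible] def pastInfo [MeasurableSpace H] (z u : ℕ → Ω → H) (t : ℕ) : MeasurableSpace Ω :=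
  (⨆ s ∈ Set.Iic t, MeasurableSpace.comap (z s) inferInstance) ⊔
    (⨆ s ∈ Set.Iio t, MeasurableSpace.comap (u s) inferInstance)

/-! ### The population operator `Q` and the estimator -/

variable [CompleteSpace H]

/-- `Q = C_xz* C_zz⁻¹ C_xz`, where `C_zz⁻¹ = ∑_j μ_j⁻¹ g_j ⊗ g_j` and `(μ_j, g_j)` are the
eigenelements of `C_zz`; since `C_xz* (g_j ⊗ g_j) C_xz = (C_xz* g_j) ⊗ (C_xz* g_j)`, this is the
following series in the Banach space of bounded operators. It converges absolutely whenever
`x` and `z` are square integrable. -/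
def popQ (Cxz : H →L[ℝ] H) (μ : ℕ → ℝ) (g : HilbertBasis ℕ ℝ H) : H →L[ℝ] H :=
  ∑' j, (μ j)⁻¹ • tens ((Cxz†) (g j)) ((Cxz†) (g j))

/-- `Q̂ = Ĉ_xz* (Ĉ_zz)_{K₁}⁻¹ Ĉ_xz`, where `K₁ = #{j : μ̂_j ^ 2 > α₁}` and `(μ̂_j, ĝ_j)` are
the eigenelements of `Ĉ_zz`. -/
def sampleQ (x z : ℕ → Ω → H) (α₁ : ℕ → ℝ) (μh : ℕ → Ω → ℕ → ℝ)
    (gh : ℕ → Ω → HilbertBasis ℕ ℝ H) (T : ℕ) (ω : Ω) : H →L[ℝ] H :=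
  (sampleOp x z T ω)† ∘L regInv (μh T ω) (gh T ω) (truncCount (μh T ω) (α₁ T)) ∘L
    sampleOp x z T ω

/-- `P̂ = Ĉ_yz* (Ĉ_zz)_{K₁}⁻¹ Ĉ_xz`. -/
def sampleP (x y z : ℕ → Ω → H) (α₁ : ℕ → ℝ) (μh : ℕ → Ω → ℕ → ℝ)
    (gh : ℕ → Ω → HilbertBasis ℕ ℝ H) (T : ℕ) (ω : Ω) : H →L[ℝ] H :=
  (sampleOp y z T ω)† ∘L regInv (μh T ω) (gh T ω) (truncCount (μh T ω) (α₁ T)) ∘L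
    sampleOp x z T ω

/-- The functional two-stage least square estimator `Ã = P̂ Q̂_{K₂}⁻¹`, where
`K₂ = #{j : ν̂_j ^ 2 > α₂}` and `(ν̂_j, ĥ_j)` are the eigenelements of `Q̂`. -/
def f2slse (x y z : ℕ → Ω → H) (α₁ α₂ : ℕ → ℝ) (μh : ℕ → Ω → ℕ → ℝ)
    (gh : ℕ → Ω → HilbertBasis ℕ ℝ H) (νh : ℕ → Ω → ℕ → ℝ)
    (hh : ℕ → Ω → HilbertBasis ℕ ℝ H) (T : ℕ) (ω : Ω) : H →L[ℝ] H :=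
  sampleP x y z α₁ μh gh T ω ∘L regInv (νh T ω) (hh T ω) (truncCount (νh T ω) (α₂ T))

/-- `Π̃_{K₂} = ∑_{j ≤ K₂} ĥ_j ⊗ ĥ_j`. -/
def projTilde (α₂ : ℕ → ℝ) (νh : ℕ → Ω → ℕ → ℝ) (hh : ℕ → Ω → HilbertBasis ℕ ℝ H)
    (T : ℕ) (ω : Ω) : H →L[ℝ] H :=
  firstProj (hh T ω) (truncCount (νh T ω) (α₂ T))

/-! ### Assumptions -/

variable [MeasurableSpace H]

/-- The basic assumptions on the observations `(x_t, y_t, z_t)`, the regression operator `A`, the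
first-stage operator `B`, the eigenelements `(μ_j, g_j)` of `C_zz = E[z ⊗ z]` and the
eigenelements `(ν_j, h_j)` of `Q`. The errors are `u_t = y_t - A x_t` and `v_t = x_t - B z_t`. -/
structure BasicAssumption (P : Measure Ω) (x y z : ℕ → Ω → H) (A B : H →L[ℝ] H)
    (μ : ℕ → ℝ) (g : HilbertBasis ℕ ℝ H) (ν : ℕ → ℝ) (h : HilbertBasis ℕ ℝ H) : Prop where
  measurable_x : ∀ t, Measurable (x t)
  measurable_y : ∀ t, Measurable (y t)
  measurable_z : ∀ t, Measurable (z t)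
  stationary : IsStationarySeq P (fun t ω => (x t ω, z t ω))
  mixing : IsGeomStrongMixing P (fun t ω => (x t ω, z t ω))
  memLp_x : ∀ t, MemLp (x t) 2 P
  memLp_z : ∀ t, MemLp (z t) 2 P
  memLp_u : ∀ t, MemLp (resid A x y t) 2 P
  mean_x : ∀ t, ∫ ω, x t ω ∂P = 0
  mean_z : ∀ t, ∫ ω, z t ω ∂P = 0
  /-- `E[u_t | past] = 0`. -/
  martingale_diff : ∀ t, P[resid A x y t | pastInfo z (resid A x y) t] =ᵐ[P] 0
  /-- `E[u_t ⊗ u_t | past] = C_uu`. -/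
  homoscedastic : ∀ t,
    P[fun ω => tens (resid A x y t ω) (resid A x y t ω) | pastInfo z (resid A x y) t]
      =ᵐ[P] fun _ => momentOp P (resid A x y 0) (resid A x y 0)
  /-- `sup_{t ≤ T} E[‖u_t‖ ^ (2 + δ) | past] < ∞`. -/
  cond_moment : ∃ δ : ℝ, 0 < δ ∧ ∀ T : ℕ, ∀ᵐ ω ∂P,
    ⨆ t ∈ Finset.range T,
      condLExp (pastInfo z (resid A x y) t) P (fun ω' => ‖resid A x y t ω'‖ₑ ^ (2 + δ)) ω < ∞
  /-- The first-stage errors `v_t` are uncorrelated with `z_t`. -/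
  first_stage : ∀ t, momentOp P (z t) (resid B z x t) = 0
  eigen_zz : IsEigensystem (momentOp P (z 0) (z 0)) μ g
  eigen_Q : IsEigensystem (popQ (momentOp P (x 0) (z 0)) μ g) ν h
  strictAnti_μ : StrictAnti μ
  pos_μ : ∀ j, 0 < μ j
  strictAnti_ν : StrictAnti ν
  pos_ν : ∀ j, 0 < ν j
  ker_Q : (popQ (momentOp P (x 0) (z 0)) μ g).ker = ⊥
  hs_A : hsNorm A < ∞
  rate_xz : IsBigOp P (fun T ω => hsNorm (sampleOp x z T ω - momentOp P (x 0) (z 0)))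
    (fun T => (T : ℝ) ^ (-(1 / 2) : ℝ))
  rate_zz : IsBigOp P (fun T ω => hsNorm (sampleOp z z T ω - momentOp P (z 0) (z 0)))
    (fun T => (T : ℝ) ^ (-(1 / 2) : ℝ))
  rate_uz : IsBigOp P
    (fun T ω => hsNorm (sampleOp (resid A x y) z T ω - momentOp P (resid A x y 0) (z 0)))
    (fun T => (T : ℝ) ^ (-(1 / 2) : ℝ))
  rate_uu : IsLittleOpOne P
    (fun T ω => hsNorm (sampleOp (resid A x y) (resid A x y) T ω -
      momentOp P (resid A x y 0) (resid A x y 0)))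
  rate_vz : IsBigOp P (fun T ω => hsNorm (sampleOp (resid B z x) z T ω))
    (fun T => (T : ℝ) ^ (-(1 / 2) : ℝ))

/-- `⟪z_t, g_j⟫ ⟪z_t, g_l⟫ - E[⟪z_t, g_j⟫ ⟪z_t, g_l⟫]`. -/
def scoreDev (P : Measure Ω) (z : ℕ → Ω → H) (g : HilbertBasis ℕ ℝ H) (j l t : ℕ) (ω : Ω) : ℝ :=
  ⟪z t ω, g j⟫ * ⟪z t ω, g l⟫ - ∫ ω', ⟪z t ω', g j⟫ * ⟪z t ω', g l⟫ ∂P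

/-- The refined assumptions, with polynomial decay and gaps of the eigenvalues of `C_zz` and `Q`
and smoothness of `A` and `B`. Sequences start at index `0`, so that the `j`-th element of the
usual numbering from `1` has index `j - 1`. -/
structure RateAssumption (P : Measure Ω) (x y z : ℕ → Ω → H) (A B : H →L[ℝ] H)
    (μ : ℕ → ℝ) (g : HilbertBasis ℕ ℝ H) (ν : ℕ → ℝ) (h : HilbertBasis ℕ ℝ H)
    (c ρμ ρν ςμ ςν γμ γν m : ℝ) : Prop extends BasicAssumption P x y z A B μ g ν h where
  c_pos : 0 < c
  hρμ : 2 < ρμ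
  hρν : 2 < ρν
  hςμ : 1 / 2 < ςμ
  hςν : 1 / 2 < ςν
  hγμ : 1 / 2 < γμ
  hγν : 1 / 2 < γν
  hm : 1 < m
  decay_μ : ∀ j : ℕ, μ j ^ 2 ≤ c * ((j : ℝ) + 1) ^ (-ρμ)
  gap_μ : ∀ j : ℕ, c⁻¹ * ((j : ℝ) + 1) ^ (-ρμ - 1) ≤ μ j ^ 2 - μ (j + 1) ^ 2
  decay_ν : ∀ j : ℕ, ν j ^ 2 ≤ c * ((j : ℝ) + 1) ^ (-ρν)
  gap_ν : ∀ j : ℕ, c⁻¹ * ((j : ℝ) + 1) ^ (-ρν - 1) ≤ ν j ^ 2 - ν (j + 1) ^ 2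
  smooth_A : ∀ j l : ℕ,
    |⟪h j, A (h l)⟫| ≤ c * ((j : ℝ) + 1) ^ (-γν) * ((l : ℝ) + 1) ^ (-ςν)
  smooth_B : ∀ j l : ℕ,
    |⟪h j, B (g l)⟫| ≤ c * ((j : ℝ) + 1) ^ (-γμ) * ((l : ℝ) + 1) ^ (-ςμ)
  /-- Decay of the lag-`s` autocovariances, `s ≥ 1`. -/
  autocov : ∀ j l t s : ℕ, 1 ≤ s →
    ∫ ω, scoreDev P z g j l (t + s) ω * scoreDev P z g j l t ω ∂P ≤
      c * (s : ℝ) ^ (-m) * ∫ ω, scoreDev P z g j l (t + s) ω ^ 2 ∂P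
  /-- `E[‖⟪z_t, g_j⟫ z_t‖ ^ 2] ≤ c μ_j`. -/
  moment_z : ∀ j t : ℕ, ∫⁻ ω, ‖⟪z t ω, g j⟫ • z t ω‖ₑ ^ 2 ∂P ≤ ENNReal.ofReal (c * μ j)
  /-- `E[‖⟪x_t, h_j⟫ z_t‖ ^ 2] ≤ c ν_j`. -/
  moment_x : ∀ j t : ℕ, ∫⁻ ω, ‖⟪x t ω, h j⟫ • z t ω‖ₑ ^ 2 ∂P ≤ ENNReal.ofReal (c * ν j)

end FIV

end

namespace FIV

/-! ### Diagonal operators, truncation of spectra, and a perturbation bound for spectral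
projections. -/

section Deterministic

variable {H : Type*} [NormedAddCommGroup H] [InnerProductSpace ℝ H]

/-! Once the cutoffs are fixed, everything is a deterministic operator inequality; probability
enters only through the `O_p(T^(-1/2))` bounds on the sample moments. Write `R₁`, `R₂` for the two
truncated inverses and `X = Ĉ_xz`, `U = Ĉ_uz`. A cutoff on squared eigenvalues means that the
retained ones are at least `√α` and the discarded ones at most `√α`.

Stochastic part. From `y = A x + u` and `Q̂ R₂ = Π̃`, the error on the estimated eigenspace is
exactly `U* R₁ X R₂` (`f2slse_sub_eq`). Since `‖R₁ a‖² ≤ α₁^(-1/2) ⟪a, R₁ a⟫` and `X* R₁ X = Q̂`,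
the quadratic form collapses to `⟪w, Q̂ w⟫` with `w = R₂ v`, which costs only `α₂^(-1/2)`
(`norm_stochastic_term_sq_le`). The martingale property gives `C_uz = 0`, so `‖U‖² = O_p(T⁻¹)`.

Bias. First-stage orthogonality gives `Q = B C_zz B*`, while `X = Ĉ_zz B* + Ĉ_vz`; hence `‖Q̂ - Q‖ =
O_p(√α₁)` (`norm_sub_first_stage_le`). Whole spectral subspaces are compared, not single
eigenvectors: if `Π` collects the population eigenvalues above `2√α₂`, a Davis-Kahan argument bounds
`Π (I - Π̃)` by `‖Q̂ - Q‖ / √α₂`. What remains is `A (I - Π)`, controlled by the decay of the matrix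
of `A` and the polynomial lower bound on `ν_j` that the eigenvalue gaps force. The resulting rate
has no maximum factor, so it is stronger than the one claimed.

Consistency. The conditions on the parameters give `1/T ≤ α₁²` and `α₁ ≤ α₂²` eventually, and both
rates tend to zero. -/

@[simp] lemma tens_apply (a b v : H) : tens a b v = ⟪a, v⟫ • b := rfl

lemma norm_tens_le (a b : H) : ‖tens a b‖ ≤ ‖a‖ * ‖b‖ := by
  refine ContinuousLinearMap.opNorm_le_bound _ (by positivity) fun v => ?_
  rw [tens_apply, norm_smul]
  nlinarith [norm_inner_le_norm (𝕜 := ℝ) a v, norm_nonneg b, norm_nonneg a, norm_nonneg v]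

/-- The tensor product of vectors as a continuous bilinear map. -/
noncomputable def tensL : H →L[ℝ] H →L[ℝ] (H →L[ℝ] H) :=
  (LinearMap.mk₂ ℝ (fun a b : H => tens a b)
    (fun a a' b => by ext v; simp [inner_add_left, add_smul])
    (fun r a b => by ext v; simp [inner_smul_left, mul_smul])
    (fun a b b' => by ext v; simp)
    (fun r a b => by ext v; simp [smul_comm r])).mkContinuous₂ 1
    (fun a b => by simpa using norm_tens_le a b)

lemma tens_adjoint [CompleteSpace H] (a b : H) : (tens a b)† = tens b a := by
  refine ContinuousLinearMap.ext fun v => ext_inner_right ℝ fun w => ?_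
  rw [ContinuousLinearMap.adjoint_inner_left]
  simp [inner_smul_left, inner_smul_right, real_inner_comm, mul_comm]

/-! ### Coordinates with respect to a Hilbert basis -/

lemma hasSum_sq_inner (e : HilbertBasis ℕ ℝ H) (v : H) :
    HasSum (fun j => ⟪e j, v⟫ ^ 2) (‖v‖ ^ 2) := by
  have := e.hasSum_inner_mul_inner v v
  rw [real_inner_self_eq_norm_sq] at this
  simpa only [real_inner_comm, ← sq] using this

/-- Parseval. The norm bounds for diagonal operators below reduce to this coordinatewise comparison.
-/
lemma norm_le_of_coord_le (e : HilbertBasis ℕ ℝ H) {v w : H} {a : ℝ} (ha : 0 ≤ a)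
    (h : ∀ j, |⟪e j, v⟫| ≤ a * |⟪e j, w⟫|) : ‖v‖ ≤ a * ‖w‖ := by
  have h1 := hasSum_le (fun j => ?_) (hasSum_sq_inner e v) ((hasSum_sq_inner e w).mul_left (a ^ 2))
  · rw [← mul_pow] at h1
    exact le_of_sq_le_sq h1 (by positivity)
  · rw [← sq_abs, ← sq_abs ⟪e j, w⟫, ← mul_pow]
    exact pow_le_pow_left₀ (abs_nonneg _) (h j) 2

lemma tendsto_inner_basis (e : HilbertBasis ℕ ℝ H) (v : H) :
    Tendsto (fun j => ⟪e j, v⟫) atTop (𝓝 0) := by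
  have := (hasSum_sq_inner e v).summable.tendsto_atTop_zero
  have h2 := this.sqrt
  simp only [Real.sqrt_sq_eq_abs, Real.sqrt_zero] at h2
  exact (tendsto_zero_iff_abs_tendsto_zero _).2 h2

lemma inner_basis (e : HilbertBasis ℕ ℝ H) (i j : ℕ) :
    ⟪e i, e j⟫ = if i = j then (1 : ℝ) else 0 := by
  classical
  exact (orthonormal_iff_ite.1 e.orthonormal) i j

lemma inner_regInv (lam : ℕ → ℝ) (e : HilbertBasis ℕ ℝ H) (K j : ℕ) (v : H) :
    ⟪e j, regInv lam e K v⟫ = if j < K then (lam j)⁻¹ * ⟪e j, v⟫ else 0 := by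
  simp [regInv, inner_sum, inner_smul_right, inner_basis]

lemma inner_firstProj (e : HilbertBasis ℕ ℝ H) (K j : ℕ) (v : H) :
    ⟪e j, firstProj e K v⟫ = if j < K then ⟪e j, v⟫ else 0 := by
  simp [firstProj, inner_sum, inner_smul_right, inner_basis]

lemma IsEigensystem.inner_apply {S : H →L[ℝ] H} {lam : ℕ → ℝ} {e : HilbertBasis ℕ ℝ H}
    (hS : IsEigensystem S lam e) (j : ℕ) (v : H) : ⟪e j, S v⟫ = lam j * ⟪e j, v⟫ := by
  have h1 := ((e.hasSum_repr v).mapL S).mapL (innerSL ℝ (e j))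
  simp only [map_smul, hS.eigen, innerSL_apply_apply, e.repr_apply_apply,
    smul_eq_mul, inner_basis] at h1
  have h2 := hasSum_single (f := fun i => ⟪e i, v⟫ * (lam i * if j = i then (1 : ℝ) else 0)) j
    (fun i hi => by simp [Ne.symm hi])
  rw [h1.unique h2]
  simp [mul_comm]

lemma eq_of_coord_eq (e : HilbertBasis ℕ ℝ H) {v w : H} (h : ∀ j, ⟪e j, v⟫ = ⟪e j, w⟫) :
    v = w := by
  apply e.repr.injective
  ext j
  simpa [e.repr_apply_apply] using h j

lemma norm_firstProj_apply_le (e : HilbertBasis ℕ ℝ H) (K : ℕ) (v : H) :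
    ‖firstProj e K v‖ ≤ ‖v‖ := by
  have := norm_le_of_coord_le e (v := firstProj e K v) (w := v) zero_le_one (fun j => by
    rw [inner_firstProj]; split_ifs <;> simp)
  simpa using this

lemma norm_compl_firstProj_apply_le (e : HilbertBasis ℕ ℝ H) (K : ℕ) (v : H) :
    ‖v - firstProj e K v‖ ≤ ‖v‖ := by
  have := norm_le_of_coord_le e (v := v - firstProj e K v) (w := v) zero_le_one (fun j => by
    rw [inner_sub_right, inner_firstProj]; split_ifs <;> simp)
  simpa using this

lemma IsEigensystem.norm_apply_compl_le {S : H →L[ℝ] H} {lam : ℕ → ℝ} {e : HilbertBasis ℕ ℝ H}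
    (hS : IsEigensystem S lam e) {K : ℕ} {t : ℝ} (ht : 0 ≤ t) (h : ∀ j, K ≤ j → |lam j| ≤ t)
    (v : H) : ‖S (v - firstProj e K v)‖ ≤ t * ‖v‖ := by
  refine norm_le_of_coord_le e ht fun j => ?_
  rw [hS.inner_apply, inner_sub_right, inner_firstProj]
  split_ifs with hj
  · simp; positivity
  · rw [sub_zero, abs_mul]
    exact mul_le_mul_of_nonneg_right (h j (not_lt.1 hj)) (abs_nonneg _)

lemma IsEigensystem.le_norm_apply_firstProj {S : H →L[ℝ] H} {lam : ℕ → ℝ}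
    {e : HilbertBasis ℕ ℝ H} (hS : IsEigensystem S lam e) {K : ℕ} {t : ℝ} (ht : 0 < t)
    (h : ∀ j, j < K → t ≤ lam j) (v : H) : t * ‖firstProj e K v‖ ≤ ‖S (firstProj e K v)‖ := by
  have := norm_le_of_coord_le e (v := firstProj e K v) (w := S (firstProj e K v))
    (inv_nonneg.2 ht.le) (fun j => by
      rw [hS.inner_apply, inner_firstProj]
      split_ifs with hj
      · rw [abs_mul, abs_of_pos (ht.trans_le (h j hj)), inv_mul_eq_div, le_div_iff₀ ht, mul_comm]
        exact mul_le_mul_of_nonneg_right (h j hj) (abs_nonneg _)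
      · simp)
  rwa [inv_mul_eq_div, le_div_iff₀ ht, mul_comm] at this

lemma IsEigensystem.apply_firstProj {S : H →L[ℝ] H} {lam : ℕ → ℝ} {e : HilbertBasis ℕ ℝ H}
    (hS : IsEigensystem S lam e) (K : ℕ) (v : H) :
    S (firstProj e K v) = firstProj e K (S v) := by
  refine eq_of_coord_eq e fun j => ?_
  rw [hS.inner_apply, inner_firstProj, inner_firstProj, hS.inner_apply]
  split_ifs <;> simp

lemma IsEigensystem.apply_regInv {S : H →L[ℝ] H} {lam : ℕ → ℝ} {e : HilbertBasis ℕ ℝ H}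
    (hS : IsEigensystem S lam e) {K : ℕ} (h : ∀ j < K, lam j ≠ 0) (v : H) :
    S (regInv lam e K v) = firstProj e K v := by
  refine eq_of_coord_eq e fun j => ?_
  rw [hS.inner_apply, inner_firstProj, inner_regInv]
  split_ifs with hj
  · field_simp [h j hj]
  · simp

lemma IsEigensystem.regInv_apply {S : H →L[ℝ] H} {lam : ℕ → ℝ} {e : HilbertBasis ℕ ℝ H}
    (hS : IsEigensystem S lam e) {K : ℕ} (h : ∀ j < K, lam j ≠ 0) (v : H) :
    regInv lam e K (S v) = firstProj e K v := by
  refine eq_of_coord_eq e fun j => ?_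
  rw [inner_firstProj, inner_regInv, hS.inner_apply]
  split_ifs with hj
  · field_simp [h j hj]
  · simp

lemma norm_regInv_apply_le {lam : ℕ → ℝ} (e : HilbertBasis ℕ ℝ H) {K : ℕ} {t : ℝ} (ht : 0 < t)
    (h : ∀ j < K, t ≤ lam j) (v : H) : ‖regInv lam e K v‖ ≤ t⁻¹ * ‖v‖ := by
  refine norm_le_of_coord_le e (inv_nonneg.2 ht.le) fun j => ?_
  rw [inner_regInv]
  split_ifs with hj
  · rw [abs_mul, abs_of_pos (inv_pos.2 (ht.trans_le (h j hj)))]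
    exact mul_le_mul_of_nonneg_right (inv_anti₀ ht (h j hj)) (abs_nonneg _)
  · simp; positivity

/-- For a nonnegative operator with norm at most `t⁻¹`, `‖R v‖ ^ 2 ≤ t⁻¹ ⟪v, R v⟫`. -/
lemma norm_regInv_apply_sq_le {lam : ℕ → ℝ} (e : HilbertBasis ℕ ℝ H) {K : ℕ} {t : ℝ} (ht : 0 < t)
    (h : ∀ j < K, t ≤ lam j) (v : H) :
    ‖regInv lam e K v‖ ^ 2 ≤ t⁻¹ * ⟪v, regInv lam e K v⟫ := by
  refine hasSum_le (fun j => ?_) (hasSum_sq_inner e (regInv lam e K v))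
    ((e.hasSum_inner_mul_inner v (regInv lam e K v)).mul_left t⁻¹)
  rw [inner_regInv, real_inner_comm (e j) v]
  split_ifs with hj
  · have h1 : (lam j)⁻¹ ≤ t⁻¹ := inv_anti₀ ht (h j hj)
    have h2 : 0 ≤ (lam j)⁻¹ := (inv_pos.2 (ht.trans_le (h j hj))).le
    have h3 : 0 ≤ (lam j)⁻¹ * ⟪e j, v⟫ ^ 2 := by positivity
    calc ((lam j)⁻¹ * ⟪e j, v⟫) ^ 2 = (lam j)⁻¹ * ((lam j)⁻¹ * ⟪e j, v⟫ ^ 2) := by ring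
      _ ≤ t⁻¹ * ((lam j)⁻¹ * ⟪e j, v⟫ ^ 2) := mul_le_mul_of_nonneg_right h1 h3
      _ = _ := by ring
  · simp

/-! ### The truncation index -/

lemma antitone_nonneg_of_tendsto_zero {lam : ℕ → ℝ} (hl : Antitone lam)
    (h0 : Tendsto lam atTop (𝓝 0)) (j : ℕ) : 0 ≤ lam j :=
  hl.le_of_tendsto h0 j

/-- An antitone sequence with limit zero is nonnegative, so its squares decrease too and the counted
set is an initial segment. The limit also makes that set finite; otherwise `Set.ncard` would return
the default value 0. -/
lemma lt_truncCount_iff {lam : ℕ → ℝ} (hl : Antitone lam) (h0 : Tendsto lam atTop (𝓝 0))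
    {α : ℝ} (hα : 0 < α) (j : ℕ) : j < truncCount lam α ↔ α < lam j ^ 2 := by
  have hnn := antitone_nonneg_of_tendsto_zero hl h0
  have hex : ∃ n, lam n ^ 2 ≤ α := by
    have h1 : Tendsto (fun n => lam n ^ 2) atTop (𝓝 0) := by simpa using h0.pow 2
    obtain ⟨n, hn⟩ := (h1.eventually (gt_mem_nhds hα)).exists
    exact ⟨n, hn.le⟩
  classical
  have hset : {j : ℕ | α < lam j ^ 2} = Finset.range (Nat.find hex) := by
    ext i
    simp only [Set.mem_ofPred_eq, Finset.coe_range, Set.mem_Iio]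
    constructor
    · intro hi
      by_contra hc
      have := pow_le_pow_left₀ (hnn i) (hl (not_lt.1 hc)) 2
      linarith [Nat.find_spec hex]
    · intro hi
      exact not_le.1 (Nat.find_min hex hi)
  have hcard : truncCount lam α = Nat.find hex := by
    rw [truncCount, hset, Set.ncard_coe_finset, Finset.card_range]
  have := Set.ext_iff.1 hset j
  simp only [Set.mem_ofPred_eq, Finset.coe_range, Set.mem_Iio] at this
  rw [hcard, this]

lemma IsEigensystem.tendsto_zero {S : H →L[ℝ] H} {lam : ℕ → ℝ} {e : HilbertBasis ℕ ℝ H}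
    (hS : IsEigensystem S lam e) (h : Tendsto (fun j => S (e j)) atTop (𝓝 0)) :
    Tendsto lam atTop (𝓝 0) := by
  have h1 := h.norm
  simp only [hS.eigen, norm_smul, e.orthonormal.1, mul_one, norm_zero] at h1
  exact tendsto_zero_iff_norm_tendsto_zero.2 h1

/-! ### The Hilbert-Schmidt norm -/

/-- Expand the argument in the basis and apply Cauchy-Schwarz to the partial sums; if the squares
are not summable the right side is infinite. -/
lemma enorm_sq_le_tsum (S : H →L[ℝ] H) (e : HilbertBasis ℕ ℝ H) :
    ‖S‖ₑ ^ 2 ≤ ∑' j, ‖S (e j)‖ₑ ^ 2 := by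
  by_cases hs : Summable fun j => ‖S (e j)‖ ^ 2
  · have hnn : ∀ j, 0 ≤ ‖S (e j)‖ ^ 2 := fun j => by positivity
    have heq : ∑' j, ‖S (e j)‖ₑ ^ 2 = ENNReal.ofReal (∑' j, ‖S (e j)‖ ^ 2) := by
      rw [ENNReal.ofReal_tsum_of_nonneg hnn hs]
      congr 1; ext j
      rw [ENNReal.ofReal_pow (norm_nonneg _), ofReal_norm]
    rw [heq, ← ofReal_norm, ← ENNReal.ofReal_pow (norm_nonneg _)]
    apply ENNReal.ofReal_le_ofReal
    have hb : ‖S‖ ≤ √(∑' j, ‖S (e j)‖ ^ 2) := by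
      refine S.opNorm_le_bound (Real.sqrt_nonneg _) fun v => ?_
      have h1 := (e.hasSum_repr v).mapL S
      have h2 := (h1.tendsto_sum_nat).norm
      refine le_of_tendsto h2 (Eventually.of_forall fun n => ?_)
      simp only [map_smul, e.repr_apply_apply]
      calc ‖∑ i ∈ Finset.range n, ⟪e i, v⟫ • S (e i)‖
          ≤ ∑ i ∈ Finset.range n, ‖S (e i)‖ * |⟪e i, v⟫| := by
            refine (norm_sum_le _ _).trans (Finset.sum_le_sum fun i _ => ?_)
            rw [norm_smul, mul_comm, Real.norm_eq_abs]
        _ ≤ √(∑ i ∈ Finset.range n, ‖S (e i)‖ ^ 2) * √(∑ i ∈ Finset.range n, |⟪e i, v⟫| ^ 2) :=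
            Real.sum_mul_le_sqrt_mul_sqrt _ _ _
        _ ≤ √(∑' j, ‖S (e j)‖ ^ 2) * ‖v‖ := by
            gcongr
            · exact hs.sum_le_tsum _ fun j _ => hnn j
            · rw [Real.sqrt_le_left (norm_nonneg _)]
              simp only [sq_abs]
              exact sum_le_hasSum _ (fun j _ => sq_nonneg _) (hasSum_sq_inner e v)
    calc ‖S‖ ^ 2 ≤ √(∑' j, ‖S (e j)‖ ^ 2) ^ 2 := by gcongr
      _ = _ := Real.sq_sqrt (tsum_nonneg hnn)
  · have : ∑' j, ‖S (e j)‖ₑ ^ 2 = ∞ := by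
      by_contra hne
      apply hs
      have := ENNReal.summable_toReal hne
      simpa [ENNReal.toReal_pow] using this
    rw [this]; exact le_top

/-- A basis must be supplied: without one the supremum in `hsNorm` would be over the empty family,
hence 0. -/
lemma enorm_le_hsNorm (S : H →L[ℝ] H) (e : HilbertBasis ℕ ℝ H) : ‖S‖ₑ ≤ hsNorm S := by
  have h1 : ‖S‖ₑ ^ 2 ≤ ⨆ e : HilbertBasis ℕ ℝ H, ∑' j, ‖S (e j)‖ₑ ^ 2 :=
    (enorm_sq_le_tsum S e).trans (le_iSup (fun e : HilbertBasis ℕ ℝ H => ∑' j, ‖S (e j)‖ₑ ^ 2) e)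
  have h2 := ENNReal.rpow_le_rpow h1 (by norm_num : (0 : ℝ) ≤ 1 / 2)
  rwa [← ENNReal.rpow_natCast, ← ENNReal.rpow_mul, show ((2 : ℕ) : ℝ) * (1 / 2) = 1 by norm_num,
    ENNReal.rpow_one] at h2

/-! ### Perturbation of spectral projections -/

/-- A one-sided Davis-Kahan bound. -/
lemma norm_firstProj_comp_compl_le {S S' : H →L[ℝ] H} {lam lam' : ℕ → ℝ}
    {e e' : HilbertBasis ℕ ℝ H} (hS : IsEigensystem S lam e) (hS' : IsEigensystem S' lam' e')
    {K K' : ℕ} {t : ℝ} (ht : 0 < t) (h : ∀ j < K, 2 * t ≤ lam j)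
    (h' : ∀ j, K' ≤ j → |lam' j| ≤ t) :
    t * ‖firstProj e K ∘L (ContinuousLinearMap.id ℝ H - firstProj e' K')‖ ≤ ‖S' - S‖ := by
  set N := firstProj e K ∘L (ContinuousLinearMap.id ℝ H - firstProj e' K') with hN
  have hNv : ∀ v, N v = firstProj e K (v - firstProj e' K' v) := fun v => rfl
  -- A self-improving bound: `‖N‖` reappears on the right with factor `1/2`, and is absorbed at the
  -- end. This is where the separation between `2 * t` and `t` is spent.
  have key : ‖N‖ ≤ (2 * t)⁻¹ * (‖N‖ * t + ‖S' - S‖) := by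
    refine N.opNorm_le_bound (by positivity) fun v => ?_
    have h1 := hS.le_norm_apply_firstProj (by positivity : 0 < 2 * t) h (v - firstProj e' K' v)
    set w := v - firstProj e' K' v with hw
    have hww : w - firstProj e' K' w = w := by
      refine eq_of_coord_eq e' fun j => ?_
      rw [hw]
      simp only [inner_sub_right, map_sub, inner_firstProj]
      split_ifs <;> simp
    have hcomm : S' w - firstProj e' K' (S' w) = S' w := by
      rw [← hS'.apply_firstProj, ← map_sub, hww]
    -- `S` commutes with its own projection; replacing `S` by `S'` costs the perturbation term, and
    -- `S' w` stays in the complementary range, so the projection acts on it as `N`.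
    have h2 : S (firstProj e K w) = N (S' w) - firstProj e K ((S' - S) w) := by
      rw [hS.apply_firstProj, hNv, hcomm, ← map_sub]
      simp
    have h3 : ‖S (firstProj e K w)‖ ≤ ‖N‖ * (t * ‖v‖) + ‖S' - S‖ * ‖v‖ := by
      rw [h2]
      refine (norm_sub_le _ _).trans (add_le_add ?_ ?_)
      · refine (N.le_opNorm _).trans ?_
        gcongr
        exact hS'.norm_apply_compl_le ht.le h' v
      · refine (norm_firstProj_apply_le _ _ _).trans (((S' - S).le_opNorm _).trans ?_)
        gcongr
        exact norm_compl_firstProj_apply_le _ _ _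
    rw [hNv, mul_assoc, inv_mul_eq_div, le_div_iff₀ (by positivity)]
    linarith
  rw [inv_mul_eq_div, le_div_iff₀ (by positivity)] at key
  linarith

/-- Insert `I = Π + (I - Π)` after `A`: the first piece is the Davis-Kahan term, and in the second
the estimated complement is a contraction. -/
lemma norm_comp_compl_firstProj_le {S S' : H →L[ℝ] H} {lam lam' : ℕ → ℝ}
    {e e' : HilbertBasis ℕ ℝ H} (hS : IsEigensystem S lam e) (hS' : IsEigensystem S' lam' e')
    {K K' : ℕ} {t : ℝ} (ht : 0 < t) (h : ∀ j < K, 2 * t ≤ lam j)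
    (h' : ∀ j, K' ≤ j → |lam' j| ≤ t) (A : H →L[ℝ] H) :
    ‖A ∘L (ContinuousLinearMap.id ℝ H - firstProj e' K')‖ ≤
      ‖A‖ * (‖S' - S‖ / t) + ‖A ∘L (ContinuousLinearMap.id ℝ H - firstProj e K)‖ := by
  have h1 : A ∘L (ContinuousLinearMap.id ℝ H - firstProj e' K') =
      A ∘L (firstProj e K ∘L (ContinuousLinearMap.id ℝ H - firstProj e' K')) +
      (A ∘L (ContinuousLinearMap.id ℝ H - firstProj e K)) ∘L
        (ContinuousLinearMap.id ℝ H - firstProj e' K') := by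
    ext v; simp; abel
  rw [h1]
  refine (norm_add_le _ _).trans (add_le_add ?_ ?_)
  · refine (ContinuousLinearMap.opNorm_comp_le _ _).trans ?_
    gcongr
    rw [le_div_iff₀ ht, mul_comm]
    exact norm_firstProj_comp_compl_le hS hS' ht h h'
  · refine (ContinuousLinearMap.opNorm_comp_le _ _).trans ?_
    refine mul_le_of_le_one_right (norm_nonneg _) ?_
    refine ContinuousLinearMap.opNorm_le_bound _ zero_le_one fun v => ?_
    rw [one_mul]
    exact norm_compl_firstProj_apply_le e' K' v

end Deterministic

/-! ### Polynomially decaying sequences and their tails. -/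

section Sequences

/-- Polynomial gaps of a nonnegative sequence force a polynomial lower bound. -/
lemma lower_bound_of_gap {a : ℕ → ℝ} {k ρ : ℝ} (hk : 0 < k) (hρ : 0 < ρ) (ha : ∀ j, 0 ≤ a j)
    (hgap : ∀ j : ℕ, k * ((j : ℝ) + 1) ^ (-ρ - 1) ≤ a j - a (j + 1)) (j : ℕ) :
    k * 2 ^ (-ρ - 1) * ((j : ℝ) + 1) ^ (-ρ) ≤ a j := by
  -- Only the `j + 1` gaps at indices `j, …, 2j` are summed. Each is comparable to the gap at `j`,
  -- because those indices plus one are at most `2 (j + 1)`; this produces the factor `2 ^ (-ρ -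
  -- 1)`.
  have h1 : ∑ i ∈ Finset.range (j + 1), (a (j + i) - a (j + (i + 1))) = a j - a (j + (j + 1)) :=
    Finset.sum_range_sub' (fun i => a (j + i)) (j + 1)
  have h2 : ∑ _i ∈ Finset.range (j + 1), k * (2 * ((j : ℝ) + 1)) ^ (-ρ - 1) ≤
      ∑ i ∈ Finset.range (j + 1), (a (j + i) - a (j + (i + 1))) := by
    refine Finset.sum_le_sum fun i hi => le_trans ?_ (hgap (j + i))
    have hi' : (i : ℝ) ≤ j := by exact_mod_cast Nat.lt_succ_iff.1 (Finset.mem_range.1 hi)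
    refine mul_le_mul_of_nonneg_left ?_ hk.le
    apply Real.rpow_le_rpow_of_nonpos (by positivity) (by push_cast; linarith) (by linarith)
  rw [h1, Finset.sum_const, Finset.card_range, nsmul_eq_mul] at h2
  have hj : (0 : ℝ) < (j : ℝ) + 1 := by positivity
  have h3 : k * 2 ^ (-ρ - 1) * ((j : ℝ) + 1) ^ (-ρ) =
      ((j + 1 : ℕ) : ℝ) * (k * (2 * ((j : ℝ) + 1)) ^ (-ρ - 1)) := by
    rw [Real.mul_rpow (by norm_num) hj.le, Real.rpow_sub_one hj.ne']
    push_cast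
    field_simp
  rw [h3]
  linarith [ha (j + (j + 1))]

/-- Discrete form of integrating `x ^ (-s)`. The increment is bounded below through `log x ≥ 1 -
1/x` and `exp y ≥ 1 + y`, at the point `n + 1`; returning to `n` costs `2 ^ s`, as `n + 1 ≤ 2 n`. -/
lemma rpow_telescope {s : ℝ} (hs : 1 < s) (j : ℕ) :
    ((j : ℝ) + 1) ^ (-s) ≤ (2 ^ s / (s - 1)) *
      (((j : ℝ) + 1) ^ (1 - s) - ((j : ℝ) + 1 + 1) ^ (1 - s)) := by
  set n : ℝ := (j : ℝ) + 1 with hn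
  have hn1 : 1 ≤ n := by rw [hn]; linarith [Nat.cast_nonneg (α := ℝ) j]
  have hn0 : 0 < n := by linarith
  have hs' : 0 < s - 1 := by linarith
  have hx : 0 < (n + 1) / n := by positivity
  have h1 : 1 + (s - 1) * (1 / (n + 1)) ≤ ((n + 1) / n) ^ (s - 1) := by
    rw [Real.rpow_def_of_pos hx, mul_comm (Real.log _)]
    have h2 := Real.one_sub_inv_le_log_of_pos hx
    have h3 : 1 - ((n + 1) / n)⁻¹ = 1 / (n + 1) := by field_simp; ring
    rw [h3] at h2
    have := Real.add_one_le_exp ((s - 1) * Real.log ((n + 1) / n))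
    have := mul_le_mul_of_nonneg_left h2 hs'.le
    linarith
  have h4 : ((n + 1) / n) ^ (s - 1) * (n + 1) ^ (1 - s) = n ^ (1 - s) := by
    rw [Real.div_rpow (by positivity) hn0.le, show 1 - s = -(s - 1) by ring,
      Real.rpow_neg (by positivity), Real.rpow_neg hn0.le]
    have := Real.rpow_pos_of_pos (by positivity : 0 < n + 1) (s - 1)
    have := Real.rpow_pos_of_pos hn0 (s - 1)
    field_simp
  have h5 : (s - 1) * (n + 1) ^ (-s) ≤ n ^ (1 - s) - (n + 1) ^ (1 - s) := by
    have h6 := mul_le_mul_of_nonneg_right h1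
      (Real.rpow_nonneg (by positivity : 0 ≤ n + 1) (1 - s))
    rw [h4] at h6
    have h7 : (n + 1) ^ (-s) = (1 / (n + 1)) * (n + 1) ^ (1 - s) := by
      rw [show -s = (1 - s) - 1 by ring, Real.rpow_sub_one (by positivity)]; ring
    rw [h7]
    linarith
  have h8 : n ^ (-s) ≤ 2 ^ s * (n + 1) ^ (-s) := by
    have : (2 : ℝ) ^ s * (n + 1) ^ (-s) = ((n + 1) / 2) ^ (-s) := by
      rw [Real.div_rpow (by positivity) (by norm_num), Real.rpow_neg (by norm_num : (0 : ℝ) ≤ 2)]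
      field_simp
    rw [this]
    exact Real.rpow_le_rpow_of_nonpos (by positivity) (by linarith) (by linarith)
  calc n ^ (-s) ≤ 2 ^ s * (n + 1) ^ (-s) := h8
    _ = (2 ^ s / (s - 1)) * ((s - 1) * (n + 1) ^ (-s)) := by field_simp
    _ ≤ _ := by gcongr

lemma tail_sum_rpow_le {s : ℝ} (hs : 1 < s) (K n : ℕ) :
    ∑ j ∈ Finset.range n, (if j < K then 0 else ((j : ℝ) + 1) ^ (-s)) ≤
      (2 ^ s / (s - 1)) * ((K : ℝ) + 1) ^ (1 - s) := by
  have hs' : 0 < s - 1 := by linarith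
  -- The subtracted term makes the induction close; `max K n` also covers the stage `n ≤ K`, where
  -- both sides are 0.
  have key : ∑ j ∈ Finset.range n, (if j < K then 0 else ((j : ℝ) + 1) ^ (-s)) ≤
      (2 ^ s / (s - 1)) * (((K : ℝ) + 1) ^ (1 - s) - (((max K n : ℕ) : ℝ) + 1) ^ (1 - s)) := by
    induction n with
    | zero => simp
    | succ n ih =>
      rw [Finset.sum_range_succ]
      split_ifs with hn
      · rw [max_eq_left hn.le] at ih
        rw [max_eq_left (Nat.succ_le_of_lt hn)]
        simpa using ih
      · have hKn := not_lt.1 hn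
        rw [max_eq_right hKn] at ih
        rw [max_eq_right (hKn.trans n.le_succ)]
        have := rpow_telescope hs n
        push_cast
        linarith
  refine key.trans ?_
  gcongr
  have : 0 ≤ (((max K n : ℕ) : ℝ) + 1) ^ (1 - s) := by positivity
  linarith

lemma summable_of_decay {a : ℕ → ℝ} {c ρ : ℝ} (ha : ∀ j, 0 ≤ a j) (hρ : 2 < ρ)
    (hd : ∀ j : ℕ, a j ^ 2 ≤ c * ((j : ℝ) + 1) ^ (-ρ)) : Summable a := by
  have hsum : Summable fun j : ℕ => ((j : ℝ) + 1) ^ (-(ρ / 2)) := by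
    have := (Real.summable_one_div_nat_add_rpow 1 (ρ / 2)).2 (by linarith)
    refine this.congr fun j => ?_
    rw [abs_of_pos (by positivity), Real.rpow_neg (by positivity), one_div]
  refine Summable.of_nonneg_of_le ha (fun j => ?_) (hsum.mul_left (√c))
  have h1 := Real.le_sqrt_of_sq_le (hd j)
  rwa [Real.sqrt_mul' _ (by positivity), Real.sqrt_eq_rpow (_ ^ _),
    ← Real.rpow_mul (by positivity), show -ρ * (1 / 2) = -(ρ / 2) by ring] at h1

end Sequences

/-! ### The truncation tail of `A`. -/

section Tail

variable {H : Type*} [NormedAddCommGroup H] [InnerProductSpace ℝ H]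

/-- If the matrix of `A` decays polynomially, then so does `A (I - Π_K)`. -/
lemma exists_norm_comp_compl_firstProj_sq_le (A : H →L[ℝ] H) (h : HilbertBasis ℕ ℝ H)
    {c γ ς : ℝ} (hγ : 1 / 2 < γ) (hς : 1 / 2 < ς)
    (hA : ∀ j l : ℕ, |⟪h j, A (h l)⟫| ≤ c * ((j : ℝ) + 1) ^ (-γ) * ((l : ℝ) + 1) ^ (-ς)) :
    ∃ C : ℝ, 0 ≤ C ∧ ∀ K : ℕ, ‖A ∘L (ContinuousLinearMap.id ℝ H - firstProj h K)‖ ^ 2 ≤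
      C * ((K : ℝ) + 1) ^ (1 - 2 * ς) := by
  have hsum : Summable fun j : ℕ => ((j : ℝ) + 1) ^ (-(2 * γ)) := by
    have := (Real.summable_one_div_nat_add_rpow 1 (2 * γ)).2 (by linarith)
    refine this.congr fun j => ?_
    rw [abs_of_pos (by positivity), Real.rpow_neg (by positivity), one_div]
  set G := ∑' j : ℕ, ((j : ℝ) + 1) ^ (-(2 * γ)) with hG
  have hG0 : 0 ≤ G := tsum_nonneg fun j => by positivity
  -- Column norms: square-summability over the row index uses `2 γ > 1`. Summing the columns beyond
  -- `K` then bounds the Hilbert-Schmidt, hence the operator, norm.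
  have hcol : ∀ l : ℕ, ‖A (h l)‖ ^ 2 ≤ c ^ 2 * G * ((l : ℝ) + 1) ^ (-(2 * ς)) := by
    intro l
    have h1 := hsum.hasSum.mul_left (c ^ 2 * ((l : ℝ) + 1) ^ (-(2 * ς)))
    refine (hasSum_le (fun j => ?_) (hasSum_sq_inner h (A (h l))) h1).trans (le_of_eq (by ring))
    rw [← sq_abs]
    refine (pow_le_pow_left₀ (abs_nonneg _) (hA j l) 2).trans (le_of_eq ?_)
    have hp : ∀ (i : ℕ) (r : ℝ), ((i : ℝ) + 1) ^ (-(2 * r)) = (((i : ℝ) + 1) ^ (-r)) ^ 2 := by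
      intro i r
      rw [← Real.rpow_natCast, ← Real.rpow_mul (by positivity)]
      congr 1; push_cast; ring
    rw [hp, hp]; ring
  refine ⟨c ^ 2 * G * (2 ^ (2 * ς) / (2 * ς - 1)), ?_, fun K => ?_⟩
  · have : 0 < 2 * ς - 1 := by linarith
    positivity
  set S := A ∘L (ContinuousLinearMap.id ℝ H - firstProj h K) with hS
  have hSl : ∀ l : ℕ, ‖S (h l)‖ ^ 2 ≤
      c ^ 2 * G * (if l < K then 0 else ((l : ℝ) + 1) ^ (-(2 * ς))) := by
    intro l
    have hpl : firstProj h K (h l) = if l < K then h l else 0 := by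
      refine eq_of_coord_eq h fun j => ?_
      rw [inner_firstProj, inner_basis]
      by_cases hjl : j = l
      · subst hjl; rw [if_pos rfl]; split_ifs <;> simp [h.orthonormal.1]
      · split_ifs <;> simp [inner_basis, hjl]
    have : S (h l) = A (h l - firstProj h K (h l)) := rfl
    rw [this, hpl]
    split_ifs with hl
    · simp
    · simpa using hcol l
  have hle : ∑' l, ‖S (h l)‖ₑ ^ 2 ≤ ENNReal.ofReal
      (c ^ 2 * G * (2 ^ (2 * ς) / (2 * ς - 1)) * ((K : ℝ) + 1) ^ (1 - 2 * ς)) := by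
    refine ENNReal.tsum_le_of_sum_range_le fun n => ?_
    have : ∀ l, ‖S (h l)‖ₑ ^ 2 = ENNReal.ofReal (‖S (h l)‖ ^ 2) := fun l => by
      rw [ENNReal.ofReal_pow (norm_nonneg _), ofReal_norm]
    simp only [this]
    rw [← ENNReal.ofReal_sum_of_nonneg fun i _ => by positivity]
    apply ENNReal.ofReal_le_ofReal
    refine (Finset.sum_le_sum fun l _ => hSl l).trans ?_
    rw [← Finset.mul_sum, mul_assoc (c ^ 2 * G)]
    exact mul_le_mul_of_nonneg_left (tail_sum_rpow_le (by linarith) K n) (by positivity)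
  have h2 := (enorm_sq_le_tsum S h).trans hle
  rw [← ofReal_norm, ← ENNReal.ofReal_pow (norm_nonneg _)] at h2
  refine (ENNReal.ofReal_le_ofReal_iff ?_).1 h2
  have : 0 < 2 * ς - 1 := by linarith
  positivity

end Tail

/-! ### Operator inequalities for the two error terms. -/

section Estimator

variable {H : Type*} [NormedAddCommGroup H] [InnerProductSpace ℝ H] [CompleteSpace H]

/-- Bound for the stochastic part of the two-stage estimator. -/
lemma norm_stochastic_term_sq_le (U X Q : H →L[ℝ] H) {μ ν : ℕ → ℝ} (g h : HilbertBasis ℕ ℝ H)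
    {K₁ K₂ : ℕ} {t₁ t₂ : ℝ} (ht₁ : 0 < t₁) (ht₂ : 0 < t₂) (hμ : ∀ j < K₁, t₁ ≤ μ j)
    (hν : ∀ j < K₂, t₂ ≤ ν j) (hQX : Q = X† ∘L regInv μ g K₁ ∘L X) (hQ : IsEigensystem Q ν h) :
    ‖U† ∘L regInv μ g K₁ ∘L X ∘L regInv ν h K₂‖ ^ 2 ≤ ‖U‖ ^ 2 * t₁⁻¹ * t₂⁻¹ := by
  have hb : ‖U† ∘L regInv μ g K₁ ∘L X ∘L regInv ν h K₂‖ ≤ √(‖U‖ ^ 2 * t₁⁻¹ * t₂⁻¹) := by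
    refine ContinuousLinearMap.opNorm_le_bound _ (Real.sqrt_nonneg _) fun v => ?_
    set w := regInv ν h K₂ v with hw
    have hw1 : ‖w‖ ≤ t₂⁻¹ * ‖v‖ := norm_regInv_apply_le h ht₂ hν v
    have hQw : Q w = firstProj h K₂ v :=
      hQ.apply_regInv (fun j hj => (ht₂.trans_le (hν j hj)).ne') v
    -- The form equals `⟪w, Q w⟫` and `Q w` is a projection of `v`, so one factor `t₂⁻¹` suffices.
    -- Bounding the factors of the product separately would give `t₁⁻² t₂⁻²` in the squared norm.
    have h1 : ⟪X w, regInv μ g K₁ (X w)⟫ ≤ t₂⁻¹ * ‖v‖ ^ 2 := by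
      have : ⟪X w, regInv μ g K₁ (X w)⟫ = ⟪w, Q w⟫ := by
        rw [hQX]; simp [ContinuousLinearMap.adjoint_inner_right]
      rw [this, hQw]
      refine (real_inner_le_norm _ _).trans ?_
      have := mul_le_mul hw1 (norm_firstProj_apply_le h K₂ v) (norm_nonneg _) (by positivity)
      linarith
    have h2 := norm_regInv_apply_sq_le g ht₁ hμ (X w)
    have h3 : ‖(U† ∘L regInv μ g K₁ ∘L X ∘L regInv ν h K₂) v‖ ≤ ‖U‖ * ‖regInv μ g K₁ (X w)‖ := by
      have := (U†).le_opNorm (regInv μ g K₁ (X w))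
      rwa [LinearIsometryEquiv.norm_map] at this
    refine h3.trans (le_of_sq_le_sq ?_ (by positivity))
    rw [mul_pow, mul_pow, Real.sq_sqrt (by positivity)]
    have h4 : ‖regInv μ g K₁ (X w)‖ ^ 2 ≤ t₁⁻¹ * (t₂⁻¹ * ‖v‖ ^ 2) :=
      h2.trans (mul_le_mul_of_nonneg_left h1 (by positivity))
    calc ‖U‖ ^ 2 * ‖regInv μ g K₁ (X w)‖ ^ 2 ≤ ‖U‖ ^ 2 * (t₁⁻¹ * (t₂⁻¹ * ‖v‖ ^ 2)) := by gcongr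
      _ = _ := by ring
  calc _ ≤ √(‖U‖ ^ 2 * t₁⁻¹ * t₂⁻¹) ^ 2 := by gcongr
    _ = _ := Real.sq_sqrt (by positivity)

/-- Perturbation bound for the first-stage operator. -/
lemma norm_sub_first_stage_le {B C D V : H →L[ℝ] H} {μ : ℕ → ℝ} {g : HilbertBasis ℕ ℝ H}
    (hD : IsEigensystem D μ g) (hDs : D† = D) {K : ℕ} {t : ℝ} (ht : 0 < t)
    (hμ : ∀ j < K, t ≤ μ j) (hμ' : ∀ j, K ≤ j → |μ j| ≤ t) :
    ‖(D ∘L B† + V)† ∘L regInv μ g K ∘L (D ∘L B† + V) - B ∘L C ∘L B†‖ ≤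
      ‖B‖ ^ 2 * (‖D - C‖ + t) + 2 * ‖B‖ * ‖V‖ + ‖V‖ ^ 2 * t⁻¹ := by
  refine ContinuousLinearMap.opNorm_le_bound _ (by positivity) fun v => ?_
  have hμ0 : ∀ j < K, μ j ≠ 0 := fun j hj => (ht.trans_le (hμ j hj)).ne'
  have hadj : (D ∘L B† + V)† = B ∘L D + V† := by
    rw [map_add, ContinuousLinearMap.adjoint_comp, ContinuousLinearMap.adjoint_adjoint, hDs]
  set w := (B†) v with hw
  set f := V v with hf
  have hwn : ‖w‖ ≤ ‖B‖ * ‖v‖ := by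
    have := (B†).le_opNorm v
    rwa [LinearIsometryEquiv.norm_map] at this
  have hfn : ‖f‖ ≤ ‖V‖ * ‖v‖ := V.le_opNorm v
  have hVn : ∀ x, ‖(V†) x‖ ≤ ‖V‖ * ‖x‖ := fun x => by
    have := (V†).le_opNorm x
    rwa [LinearIsometryEquiv.norm_map] at this
  -- With `R` the truncated inverse of `D`, the products `D R` and `R D` are the projection on the
  -- retained eigenvectors. Only the term quadratic in `V` keeps an inverse; the discarded part of
  -- `D` is at most `t`.
  have hexp : ((D ∘L B† + V)† ∘L regInv μ g K ∘L (D ∘L B† + V) - B ∘L C ∘L B†) v =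
      B ((D - C) w) - B (D (w - firstProj g K w)) + B (firstProj g K f) +
        (V†) (firstProj g K w) + (V†) (regInv μ g K f) := by
    rw [hadj]
    have h1 : regInv μ g K (D w + f) = firstProj g K w + regInv μ g K f := by
      rw [map_add, hD.regInv_apply hμ0]
    have h2 : ((B ∘L D + V†) ∘L regInv μ g K ∘L (D ∘L B† + V) - B ∘L C ∘L B†) v =
        B (D (regInv μ g K (D w + f))) + (V†) (regInv μ g K (D w + f)) - B (C w) := rfl
    rw [h2, h1, map_add D, hD.apply_regInv hμ0]
    simp only [map_add, map_sub, sub_apply]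
    abel
  rw [hexp]
  have e1 : ‖B ((D - C) w)‖ ≤ ‖B‖ * (‖D - C‖ * (‖B‖ * ‖v‖)) :=
    (B.le_opNorm _).trans (by gcongr; exact ((D - C).le_opNorm w).trans (by gcongr))
  have e2 : ‖B (D (w - firstProj g K w))‖ ≤ ‖B‖ * (t * (‖B‖ * ‖v‖)) :=
    (B.le_opNorm _).trans (by gcongr; exact (hD.norm_apply_compl_le ht.le hμ' w).trans (by gcongr))
  have e3 : ‖B (firstProj g K f)‖ ≤ ‖B‖ * (‖V‖ * ‖v‖) :=
    (B.le_opNorm _).trans (by gcongr; exact (norm_firstProj_apply_le g K f).trans hfn)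
  have e4 : ‖(V†) (firstProj g K w)‖ ≤ ‖V‖ * (‖B‖ * ‖v‖) :=
    (hVn _).trans (by gcongr; exact (norm_firstProj_apply_le g K w).trans hwn)
  have e5 : ‖(V†) (regInv μ g K f)‖ ≤ ‖V‖ * (t⁻¹ * (‖V‖ * ‖v‖)) :=
    (hVn _).trans (by gcongr; exact (norm_regInv_apply_le g ht hμ f).trans (by gcongr))
  calc _ ≤ ‖B ((D - C) w)‖ + ‖B (D (w - firstProj g K w))‖ + ‖B (firstProj g K f)‖ +
        ‖(V†) (firstProj g K w)‖ + ‖(V†) (regInv μ g K f)‖ := by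
        refine (norm_add_le _ _).trans (add_le_add ((norm_add_le _ _).trans (add_le_add
          ((norm_add_le _ _).trans (add_le_add (norm_sub_le _ _) le_rfl)) le_rfl)) le_rfl)
    _ ≤ _ := add_le_add (add_le_add (add_le_add (add_le_add e1 e2) e3) e4) e5
    _ = _ := by ring

end Estimator

/-! ### Sample and population moment operators. -/

section Moments

variable {H : Type*} [NormedAddCommGroup H] [InnerProductSpace ℝ H] {Ω : Type*}

lemma sampleOp_apply (a b : ℕ → Ω → H) (T : ℕ) (ω : Ω) (v : H) :
    sampleOp a b T ω v = (T : ℝ)⁻¹ • ∑ t ∈ Finset.range T, ⟪a t ω, v⟫ • b t ω := by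
  simp [sampleOp]

lemma sampleOp_adjoint [CompleteSpace H] (a b : ℕ → Ω → H) (T : ℕ) (ω : Ω) :
    (sampleOp a b T ω)† = sampleOp b a T ω := by
  simp [sampleOp, map_sum, tens_adjoint]

/-- A finite sum of rank-one operators, and the coordinates of each fixed vector tend to zero. Hence
the sample eigenvalues tend to zero, as the truncation index requires. -/
lemma sampleOp_tendsto_zero (a b : ℕ → Ω → H) (T : ℕ) (ω : Ω) (e : HilbertBasis ℕ ℝ H) :
    Tendsto (fun j => sampleOp a b T ω (e j)) atTop (𝓝 0) := by
  simp only [sampleOp_apply]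
  have h1 : Tendsto (fun j => ∑ t ∈ Finset.range T, ⟪a t ω, e j⟫ • b t ω) atTop (𝓝 0) := by
    have : (0 : H) = ∑ t ∈ Finset.range T, (0 : ℝ) • b t ω := by simp
    rw [this]
    refine tendsto_finsetSum _ fun t _ => Tendsto.smul_const ?_ _
    simpa only [real_inner_comm] using tendsto_inner_basis e (a t ω)
  simpa using h1.const_smul (T : ℝ)⁻¹

/-- Substitute `b = S a + error` in the first tensor slot, where `S` moves across the inner product
as its adjoint. It serves both stages: `S = A` for the outcome equation, `S = B` for the
instruments. -/
lemma sampleOp_eq_comp_adjoint_add [CompleteSpace H] (S : H →L[ℝ] H) (a b z : ℕ → Ω → H) (T : ℕ)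
    (ω : Ω) : sampleOp b z T ω = sampleOp a z T ω ∘L S† + sampleOp (resid S a b) z T ω := by
  ext v
  simp only [add_apply, ContinuousLinearMap.comp_apply, sampleOp_apply,
    ContinuousLinearMap.adjoint_inner_right, ← smul_add, ← Finset.sum_add_distrib, ← add_smul,
    resid, inner_sub_left]
  simp

variable [MeasurableSpace Ω] {P : Measure Ω}

lemma integrable_tens {a b : Ω → H} (ha : MemLp a 2 P) (hb : MemLp b 2 P) :
    Integrable (fun ω => tens (a ω) (b ω)) P := by
  have h1 : Integrable (fun ω => ‖a ω‖ * ‖b ω‖) P := ha.norm.integrable_mul hb.norm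
  refine h1.mono' ?_ (Eventually.of_forall fun ω => norm_tens_le _ _)
  exact tensL.aestronglyMeasurable_comp₂ ha.1 hb.1

lemma momentOp_apply {a b : Ω → H} (ha : MemLp a 2 P) (hb : MemLp b 2 P) (v : H) :
    momentOp P a b v = ∫ ω, ⟪a ω, v⟫ • b ω ∂P :=
  ContinuousLinearMap.integral_apply (integrable_tens ha hb) v

lemma inner_momentOp [CompleteSpace H] {a b : Ω → H} (ha : MemLp a 2 P) (hb : MemLp b 2 P) (v w : H) :
    ⟪w, momentOp P a b v⟫ = ∫ ω, ⟪a ω, v⟫ * ⟪b ω, w⟫ ∂P := by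
  have h1 : Integrable (fun ω => ⟪a ω, v⟫ • b ω) P :=
    (integrable_tens ha hb).apply_continuousLinearMap v
  rw [momentOp_apply ha hb, ← integral_inner h1]
  simp [inner_smul_right, real_inner_comm]

lemma momentOp_adjoint [CompleteSpace H] {a b : Ω → H} (ha : MemLp a 2 P) (hb : MemLp b 2 P) :
    (momentOp P a b)† = momentOp P b a := by
  refine ContinuousLinearMap.ext fun v => ext_inner_right ℝ fun w => ?_
  rw [ContinuousLinearMap.adjoint_inner_left, inner_momentOp ha hb, real_inner_comm,
    inner_momentOp hb ha]
  simp only [mul_comm]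

lemma momentOp_resid [CompleteSpace H] {a b : Ω → H} (S : H →L[ℝ] H) (ha : MemLp a 2 P) (hb : MemLp b 2 P) :
    momentOp P a (fun ω => b ω - S (a ω)) = momentOp P a b - S ∘L momentOp P a a := by
  have h1 : ∀ ω, tens (a ω) (b ω - S (a ω)) =
      tens (a ω) (b ω) - ContinuousLinearMap.compL ℝ H H H S (tens (a ω) (a ω)) := fun ω => by
    ext v; simp [smul_sub]
  have h2 := integrable_tens ha ha
  rw [momentOp]
  simp only [h1]
  rw [integral_sub (integrable_tens ha hb) (ContinuousLinearMap.integrable_comp _ h2),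
    ContinuousLinearMap.integral_comp_comm _ h2]
  rfl

/-- Under the first-stage orthogonality, `Q = B C_zz B*`. -/
lemma popQ_eq [CompleteSpace H] {C Cxz B : H →L[ℝ] H} {μ : ℕ → ℝ} {g : HilbertBasis ℕ ℝ H}
    (hC : IsEigensystem C μ g) (hμ : ∀ j, 0 < μ j) (hs : Summable μ) (hB : (Cxz†) = B ∘L C) :
    popQ Cxz μ g = B ∘L C ∘L B† := by
  have hterm : ∀ j, (μ j)⁻¹ • tens ((Cxz†) (g j)) ((Cxz†) (g j)) =
      μ j • tens (B (g j)) (B (g j)) := by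
    intro j
    have : (Cxz†) (g j) = μ j • B (g j) := by rw [hB]; simp [hC.eigen]
    rw [this]
    have hne := (hμ j).ne'
    ext v
    simp only [smul_apply, tens_apply, inner_smul_left, smul_smul, conj_trivial]
    congr 1
    field_simp
  -- Summability of the eigenvalues makes the series converge in operator norm, so that the `tsum`
  -- is not the default value 0.
  have hsum : Summable fun j => μ j • tens (B (g j)) (B (g j)) := by
    refine Summable.of_norm_bounded (hs.mul_right (‖B‖ ^ 2)) fun j => ?_
    rw [norm_smul, Real.norm_of_nonneg (hμ j).le]
    refine mul_le_mul_of_nonneg_left ((norm_tens_le _ _).trans ?_) (hμ j).le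
    have : ‖B (g j)‖ ≤ ‖B‖ := by simpa [g.orthonormal.1] using B.le_opNorm (g j)
    rw [sq]; gcongr
  ext v
  have h1 := (hsum.hasSum.mapL (ContinuousLinearMap.apply ℝ H v))
  have h2 := ((g.hasSum_repr ((B†) v)).mapL C).mapL B
  simp only [map_smul, hC.eigen, g.repr_apply_apply,
    ContinuousLinearMap.adjoint_inner_right] at h2
  simp only [popQ, hterm]
  have h3 : (fun j => ContinuousLinearMap.apply ℝ H v (μ j • tens (B (g j)) (B (g j)))) =
      fun j => ⟪B (g j), v⟫ • μ j • B (g j) := by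
    ext j
    simp only [ContinuousLinearMap.apply_apply, smul_apply, tens_apply, smul_smul, mul_comm]
  rw [h3] at h1
  exact h1.unique h2

end Moments

/-- A martingale difference is uncorrelated with every square-integrable variable that is
measurable with respect to the past. -/
lemma momentOp_eq_zero_of_condExp {H : Type*} [NormedAddCommGroup H] [InnerProductSpace ℝ H]
    [CompleteSpace H] {Ω : Type*} {m m0 : MeasurableSpace Ω} {P : Measure Ω} [IsFiniteMeasure P]
    {u z : Ω → H} (hm : m ≤ m0) (hu : MemLp u 2 P) (hz : MemLp z 2 P)
    (hzm : StronglyMeasurable[m] z) (hc : P[u | m] =ᵐ[P] 0) : momentOp P u z = 0 := by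
  refine ContinuousLinearMap.ext fun v => ext_inner_left ℝ fun w => ?_
  rw [inner_momentOp hu hz, zero_apply, inner_zero_right]
  have hzw : StronglyMeasurable[m] fun ω => ⟪z ω, w⟫ :=
    (continuous_id.inner continuous_const).comp_stronglyMeasurable hzm
  have huv : Integrable (fun ω => ⟪u ω, v⟫) P := (hu.inner_const v).integrable one_le_two
  have huz : Integrable (fun ω => ⟪u ω, v⟫ * ⟪z ω, w⟫) P :=
    (hu.inner_const v).integrable_mul (hz.inner_const w)
  have h1 : P[fun ω => ⟪u ω, v⟫ | m] =ᵐ[P] 0 := by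
    have h2 := (innerSL ℝ v).comp_condExp_comm (m := m) (hu.integrable one_le_two)
    have h3 : (innerSL ℝ v ∘ u) = fun ω => ⟪u ω, v⟫ := by
      ext ω; simp [real_inner_comm]
    rw [h3] at h2
    filter_upwards [h2, hc] with ω h4 h5
    rw [← h4]
    simp [h5]
  have h2 : P[fun ω => ⟪u ω, v⟫ * ⟪z ω, w⟫ | m] =ᵐ[P]
      P[fun ω => ⟪u ω, v⟫ | m] * fun ω => ⟪z ω, w⟫ :=
    condExp_mul_of_stronglyMeasurable_right hzw huz huv
  rw [← integral_condExp hm, integral_congr_ae h2]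
  refine integral_eq_zero_of_ae ?_
  filter_upwards [h1] with ω hω
  simp [hω]

/-! ### Calculus of stochastic orders. -/

section Stochastic

variable {Ω : Type*} [MeasurableSpace Ω] {P : Measure Ω}

/-- A union bound with `ε / 2` for each input reduces the claim to a deterministic implication at
one common constant, the maximum of the two and of 0. The constant `M'` may depend on `M` but not on
`T` or `ω`. -/
lemma IsBigOp.mono_of_forall {X₁ X₂ Y : ℕ → Ω → ℝ≥0∞} {r₁ r₂ r : ℕ → ℝ} (h₁ : IsBigOp P X₁ r₁)
    (h₂ : IsBigOp P X₂ r₂) (hr₁ : ∀ T, 0 ≤ r₁ T) (hr₂ : ∀ T, 0 ≤ r₂ T)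
    (h : ∀ M : ℝ, 0 ≤ M → ∃ M' : ℝ, ∀ᶠ T in atTop, ∀ ω,
      X₁ T ω ≤ ENNReal.ofReal (M * r₁ T) → X₂ T ω ≤ ENNReal.ofReal (M * r₂ T) →
      Y T ω ≤ ENNReal.ofReal (M' * r T)) : IsBigOp P Y r := by
  intro ε hε
  obtain ⟨M₁, hM₁⟩ := h₁ (ε / 2) (by positivity)
  obtain ⟨M₂, hM₂⟩ := h₂ (ε / 2) (by positivity)
  obtain ⟨M', hM'⟩ := h (max 0 (max M₁ M₂)) (le_max_left _ _)
  refine ⟨M', ?_⟩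
  filter_upwards [hM₁, hM₂, hM'] with T h1 h2 h3
  have hsub : {ω | ENNReal.ofReal (M' * r T) < Y T ω} ⊆
      {ω | ENNReal.ofReal (M₁ * r₁ T) < X₁ T ω} ∪ {ω | ENNReal.ofReal (M₂ * r₂ T) < X₂ T ω} := by
    intro ω hω
    by_contra hc
    rw [Set.mem_union, not_or] at hc
    obtain ⟨hc1, hc2⟩ := hc
    refine absurd (h3 ω ((not_lt.1 hc1).trans ?_) ((not_lt.1 hc2).trans ?_)) (not_le.2 hω)
    · exact ENNReal.ofReal_le_ofReal (mul_le_mul_of_nonneg_right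
        ((le_max_left _ _).trans (le_max_right _ _)) (hr₁ T))
    · exact ENNReal.ofReal_le_ofReal (mul_le_mul_of_nonneg_right
        ((le_max_right _ _).trans (le_max_right _ _)) (hr₂ T))
  calc _ ≤ _ := measure_mono hsub
    _ ≤ _ := measure_union_le _ _
    _ ≤ ENNReal.ofReal (ε / 2) + ENNReal.ofReal (ε / 2) := add_le_add h1 h2
    _ = ENNReal.ofReal ε := by
      rw [← ENNReal.ofReal_add (by positivity) (by positivity), add_halves]

lemma IsBigOp.tendstoInMeasure {E : Type*} [NormedAddCommGroup E] {F : ℕ → Ω → E} {f : Ω → E}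
    {r : ℕ → ℝ} (h : IsBigOp P (fun T ω => ‖F T ω - f ω‖ₑ ^ 2) r) (hr : Tendsto r atTop (𝓝 0)) :
    TendstoInMeasure P F atTop f := by
  rw [tendstoInMeasure_iff_norm]
  intro ε hε
  rw [ENNReal.tendsto_nhds_zero]
  intro η hη
  -- The tolerance may be infinite, whereas `IsBigOp` expects a real one.
  obtain ⟨δ, hδ0, hδ⟩ : ∃ δ : ℝ, 0 < δ ∧ ENNReal.ofReal δ ≤ η := by
    rcases eq_or_ne η ∞ with rfl | hne
    · exact ⟨1, one_pos, le_top⟩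
    · exact ⟨η.toReal, ENNReal.toReal_pos hη.ne' hne, ENNReal.ofReal_toReal_le⟩
  obtain ⟨M, hM⟩ := h δ hδ0
  have h1 : Tendsto (fun T => M * r T) atTop (𝓝 0) := by simpa using hr.const_mul M
  filter_upwards [hM, h1.eventually (gt_mem_nhds (by positivity : 0 < ε ^ 2))] with T h2 h3
  refine (measure_mono fun ω hω => ?_).trans (h2.trans hδ)
  have h4 : ε ≤ ‖F T ω - f ω‖ := hω
  change ENNReal.ofReal (M * r T) < ‖F T ω - f ω‖ₑ ^ 2
  rw [← ofReal_norm, ← ENNReal.ofReal_pow (norm_nonneg _)]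
  refine (ENNReal.ofReal_lt_ofReal_iff (pow_pos (hε.trans_le h4) 2)).2 (h3.trans_le ?_)
  gcongr

end Stochastic

/-! ### Comparison of the sample size with the two regularization parameters. -/

section Rates

/-- The rates of the two regularization parameters imply `1 / T ≤ α₁ ^ 2` and `α₁ ≤ α₂ ^ 2`. -/
lemma eventually_regularization_bounds {α₁ α₂ : ℕ → ℝ} {ρμ ρν : ℝ} (hμ : 0 < ρμ) (hν : 0 < ρν)
    (h₁ : ∀ T, 0 < α₁ T) (h₂ : ∀ T, 0 < α₂ T) (hl₁ : Tendsto α₁ atTop (𝓝 0))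
    (hr₁ : (fun T : ℕ => (α₁ T)⁻¹) =o[atTop] fun T : ℕ => (T : ℝ) ^ (ρμ / (2 * ρμ + 2)))
    (hr₂ : (fun T : ℕ => (α₂ T)⁻¹) =o[atTop] fun T : ℕ => (α₁ T) ^ (-ρν / (2 * ρν + 2))) :
    ∀ᶠ T : ℕ in atTop, α₁ T ≤ 1 ∧ (T : ℝ)⁻¹ ≤ α₁ T ^ 2 ∧ α₁ T ≤ α₂ T ^ 2 := by
  filter_upwards [eventually_gt_atTop 0, hl₁.eventually (ge_mem_nhds one_pos),
    hr₁.bound one_pos, hr₂.bound one_pos] with T hT h1 h3 h4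
  have hT' : (1 : ℝ) ≤ T := by exact_mod_cast hT
  have hT0 : (0 : ℝ) < T := by linarith
  have p1 := h₁ T
  have p2 := h₂ T
  rw [one_mul, Real.norm_of_nonneg (by positivity), Real.norm_of_nonneg (by positivity)] at h3 h4
  refine ⟨h1, ?_, ?_⟩
  · have h5 : (α₁ T)⁻¹ ≤ (T : ℝ) ^ (1 / 2 : ℝ) := by
      refine h3.trans (Real.rpow_le_rpow_of_exponent_le hT' ?_)
      -- The exponent `ρ / (2 ρ + 2)` is below `1/2`.
      rw [div_le_div_iff₀ (by positivity) (by norm_num)]; linarith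
    have h6 := pow_le_pow_left₀ (by positivity) h5 2
    rw [← Real.sqrt_eq_rpow, Real.sq_sqrt hT0.le, inv_pow] at h6
    exact inv_le_of_inv_le₀ (by positivity) h6
  · have h5 : (α₂ T)⁻¹ ≤ (α₁ T) ^ (-(1 / 2) : ℝ) := by
      refine h4.trans (Real.rpow_le_rpow_of_exponent_ge p1 h1 ?_)
      rw [neg_div, neg_le_neg_iff, div_le_div_iff₀ (by positivity) (by norm_num)]; linarith
    have h6 := pow_le_pow_left₀ (by positivity) h5 2
    rw [Real.rpow_neg p1.le, ← Real.sqrt_eq_rpow, inv_pow, inv_pow, Real.sq_sqrt p1.le] at h6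
    exact (inv_le_inv₀ (by positivity) p1).1 h6

end Rates

/-! ### Cutoffs and norm conversions. -/

section Auxiliary

variable {H : Type*} [NormedAddCommGroup H] [InnerProductSpace ℝ H]

lemma truncCount_bounds {lam : ℕ → ℝ} (hl : Antitone lam) (h0 : Tendsto lam atTop (𝓝 0)) {α : ℝ}
    (hα : 0 < α) : (∀ j < truncCount lam α, √α ≤ lam j) ∧
      ∀ j, truncCount lam α ≤ j → |lam j| ≤ √α := by
  refine ⟨fun j hj => ?_, fun j hj => ?_⟩
  · exact Real.sqrt_le_iff.2
      ⟨antitone_nonneg_of_tendsto_zero hl h0 j, ((lt_truncCount_iff hl h0 hα j).1 hj).le⟩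
  · refine Real.abs_le_sqrt (not_lt.1 fun h => ?_)
    exact absurd ((lt_truncCount_iff hl h0 hα j).2 h) (not_lt.2 hj)

lemma norm_le_of_hsNorm_le {S : H →L[ℝ] H} (e : HilbertBasis ℕ ℝ H) {a : ℝ} (ha : 0 ≤ a)
    (h : hsNorm S ≤ ENNReal.ofReal a) : ‖S‖ ≤ a := by
  have := (enorm_le_hsNorm S e).trans h
  rw [← ofReal_norm] at this
  exact (ENNReal.ofReal_le_ofReal_iff ha).1 this

lemma enorm_sq_le_ofReal {E : Type*} [NormedAddCommGroup E] {a : E} {b : ℝ} (h : ‖a‖ ^ 2 ≤ b) :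
    ‖a‖ₑ ^ 2 ≤ ENNReal.ofReal b := by
  rw [← ofReal_norm, ← ENNReal.ofReal_pow (norm_nonneg _)]
  exact ENNReal.ofReal_le_ofReal h

/-- Also true at `T = 0`, where both sides are 0 by convention. -/
lemma rpow_neg_half_sq (T : ℕ) : ((T : ℝ) ^ (-(1 / 2) : ℝ)) ^ 2 = (T : ℝ)⁻¹ := by
  rw [← Real.rpow_natCast, ← Real.rpow_mul (Nat.cast_nonneg T), ← Real.rpow_neg_one]
  norm_num

lemma rpow_neg_half_eq {a : ℝ} (ha : 0 < a) : a ^ (-(1 / 2) : ℝ) = (√a)⁻¹ := by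
  rw [Real.rpow_neg ha.le, Real.sqrt_eq_rpow]

end Auxiliary

/-! ### Consequences of the model equations. -/

section Model

variable {H : Type*} [NormedAddCommGroup H] [InnerProductSpace ℝ H] [CompleteSpace H]
  {Ω : Type*}

lemma sampleQ_tendsto_zero (x z : ℕ → Ω → H) (α₁ : ℕ → ℝ) (μh : ℕ → Ω → ℕ → ℝ)
    (gh : ℕ → Ω → HilbertBasis ℕ ℝ H) (T : ℕ) (ω : Ω) (e : HilbertBasis ℕ ℝ H) :
    Tendsto (fun j => sampleQ x z α₁ μh gh T ω (e j)) atTop (𝓝 0) := by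
  have h1 := ((sampleOp x z T ω)† ∘L
    regInv (μh T ω) (gh T ω) (truncCount (μh T ω) (α₁ T))).continuous.tendsto 0
  rw [map_zero] at h1
  exact h1.comp (sampleOp_tendsto_zero x z T ω e)

/-- The estimation error of the two-stage estimator on the estimated eigenspace. -/
lemma f2slse_sub_eq (x y z : ℕ → Ω → H) (A : H →L[ℝ] H) (α₁ α₂ : ℕ → ℝ) (μh : ℕ → Ω → ℕ → ℝ)
    (gh : ℕ → Ω → HilbertBasis ℕ ℝ H) (νh : ℕ → Ω → ℕ → ℝ) (hh : ℕ → Ω → HilbertBasis ℕ ℝ H)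
    {T : ℕ} {ω : Ω} (hQ : IsEigensystem (sampleQ x z α₁ μh gh T ω) (νh T ω) (hh T ω))
    (hν : ∀ j < truncCount (νh T ω) (α₂ T), νh T ω j ≠ 0) :
    f2slse x y z α₁ α₂ μh gh νh hh T ω - A ∘L projTilde α₂ νh hh T ω =
      (sampleOp (resid A x y) z T ω)† ∘L
        regInv (μh T ω) (gh T ω) (truncCount (μh T ω) (α₁ T)) ∘L sampleOp x z T ω ∘L
          regInv (νh T ω) (hh T ω) (truncCount (νh T ω) (α₂ T)) := by
  have h1 : (sampleOp y z T ω)† =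
      A ∘L (sampleOp x z T ω)† + (sampleOp (resid A x y) z T ω)† := by
    rw [sampleOp_eq_comp_adjoint_add A x y z T ω, map_add, ContinuousLinearMap.adjoint_comp,
      ContinuousLinearMap.adjoint_adjoint]
  ext v
  have h2 := hQ.apply_regInv hν v
  have h3 : A (projTilde α₂ νh hh T ω v) = A (sampleQ x z α₁ μh gh T ω
      (regInv (νh T ω) (hh T ω) (truncCount (νh T ω) (α₂ T)) v)) := by rw [h2]; rfl
  rw [sub_apply, ContinuousLinearMap.comp_apply A, h3, f2slse, sampleP, h1, sampleQ]
  simp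

variable [MeasurableSpace H] [MeasurableSpace Ω]
  {P : Measure Ω} {x y z : ℕ → Ω → H} {A B : H →L[ℝ] H} {μ : ℕ → ℝ}
  {g : HilbertBasis ℕ ℝ H} {ν : ℕ → ℝ} {h : HilbertBasis ℕ ℝ H}

/-- The information preceding `u_0` already contains `z_0`, so the martingale property applies. -/
lemma BasicAssumption.momentOp_uz_eq_zero [BorelSpace H] [SecondCountableTopology H]
    [IsProbabilityMeasure P]
    (hb : BasicAssumption P x y z A B μ g ν h) :
    momentOp P (resid A x y 0) (z 0) = 0 := by
  have hum : ∀ t, Measurable (resid A x y t) := fun t =>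
    (hb.measurable_y t).sub (A.continuous.measurable.comp (hb.measurable_x t))
  have hm : pastInfo z (resid A x y) 0 ≤ ‹MeasurableSpace Ω› :=
    sup_le (iSup₂_le fun s _ => (hb.measurable_z s).comap_le)
      (iSup₂_le fun s _ => (hum s).comap_le)
  have hz : Measurable[pastInfo z (resid A x y) 0] (z 0) :=
    measurable_iff_comap_le.2 (le_sup_of_le_left
      (le_iSup₂_of_le (f := fun s (_ : s ∈ Set.Iic 0) =>
        MeasurableSpace.comap (z s) inferInstance) 0 (Set.mem_Iic.2 le_rfl) le_rfl))
  exact momentOp_eq_zero_of_condExp hm (hb.memLp_u 0) (hb.memLp_z 0) hz.stronglyMeasurable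
    (hb.martingale_diff 0)

/-- Orthogonality of `v` and `z` is the normal equation `C_zx = B C_zz`. -/
lemma BasicAssumption.popQ_eq (hb : BasicAssumption P x y z A B μ g ν h) (hs : Summable μ) :
    popQ (momentOp P (x 0) (z 0)) μ g = B ∘L momentOp P (z 0) (z 0) ∘L B† := by
  refine FIV.popQ_eq hb.eigen_zz hb.pos_μ hs ?_
  rw [momentOp_adjoint (hb.memLp_x 0) (hb.memLp_z 0)]
  have h1 := hb.first_stage 0
  have h2 := momentOp_resid B (hb.memLp_z 0) (hb.memLp_x 0)
  exact sub_eq_zero.1 (h2.symm.trans h1)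

end Model

/-! ### The two stochastic rates. -/

section Main

variable {H : Type*} [NormedAddCommGroup H] [InnerProductSpace ℝ H] [CompleteSpace H]
  [MeasurableSpace H] {Ω : Type*} [MeasurableSpace Ω] {P : Measure Ω}
  {x y z : ℕ → Ω → H} {A B : H →L[ℝ] H} {μ : ℕ → ℝ}
  {g : HilbertBasis ℕ ℝ H} {ν : ℕ → ℝ} {h : HilbertBasis ℕ ℝ H}

/-- `‖Ã - A Π̃‖ ^ 2 = O_p(T⁻¹ α₁ ^ (-1/2) α₂ ^ (-1/2))`. -/
lemma isBigOp_stochastic_error [BorelSpace H] [SecondCountableTopology H]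
    [IsProbabilityMeasure P] (hb : BasicAssumption P x y z A B μ g ν h)
    {α₁ α₂ : ℕ → ℝ} (hα₁ : ∀ T, 0 < α₁ T) (hα₂ : ∀ T, 0 < α₂ T)
    (μh : ℕ → Ω → ℕ → ℝ) (gh : ℕ → Ω → HilbertBasis ℕ ℝ H)
    (hzz : ∀ T ω, IsEigensystem (sampleOp z z T ω) (μh T ω) (gh T ω))
    (νh : ℕ → Ω → ℕ → ℝ) (hh : ℕ → Ω → HilbertBasis ℕ ℝ H)
    (hQ : ∀ T ω, IsEigensystem (sampleQ x z α₁ μh gh T ω) (νh T ω) (hh T ω)) :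
    IsBigOp P
      (fun T ω => ‖f2slse x y z α₁ α₂ μh gh νh hh T ω - A ∘L projTilde α₂ νh hh T ω‖ₑ ^ 2)
      (fun T => (T : ℝ)⁻¹ * (α₁ T) ^ (-(1 / 2) : ℝ) * (α₂ T) ^ (-(1 / 2) : ℝ)) := by
  have hU := hb.rate_uz
  rw [hb.momentOp_uz_eq_zero] at hU
  simp only [sub_zero] at hU
  refine hU.mono_of_forall hU (fun T => by positivity) (fun T => by positivity) fun M hM =>
    ⟨M ^ 2, Eventually.of_forall fun T ω hω _ => enorm_sq_le_ofReal ?_⟩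
  have hUn := norm_le_of_hsNorm_le g (by positivity) hω
  obtain ⟨hμ1, -⟩ := truncCount_bounds (hzz T ω).antitone
    ((hzz T ω).tendsto_zero (sampleOp_tendsto_zero _ _ _ _ _)) (hα₁ T)
  obtain ⟨hν1, -⟩ := truncCount_bounds (hQ T ω).antitone
    ((hQ T ω).tendsto_zero (sampleQ_tendsto_zero _ _ _ _ _ _ _ _)) (hα₂ T)
  have ht₁ := Real.sqrt_pos.2 (hα₁ T)
  have ht₂ := Real.sqrt_pos.2 (hα₂ T)
  rw [f2slse_sub_eq x y z A α₁ α₂ μh gh νh hh (hQ T ω)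
    fun j hj => (ht₂.trans_le (hν1 j hj)).ne']
  refine (norm_stochastic_term_sq_le (sampleOp (resid A x y) z T ω) (sampleOp x z T ω)
    (sampleQ x z α₁ μh gh T ω) (gh T ω) (hh T ω) ht₁ ht₂ hμ1 hν1 rfl (hQ T ω)).trans ?_
  rw [rpow_neg_half_eq (hα₁ T), rpow_neg_half_eq (hα₂ T)]
  have h1 := pow_le_pow_left₀ (norm_nonneg _) hUn 2
  rw [mul_pow, rpow_neg_half_sq] at h1
  calc _ ≤ M ^ 2 * (T : ℝ)⁻¹ * (√(α₁ T))⁻¹ * (√(α₂ T))⁻¹ := by gcongr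
    _ = _ := by ring

variable {c ρμ ρν ςμ ςν γμ γν m : ℝ}

/-- The regularization bias satisfies
`‖A (I - Π̃)‖ ^ 2 = O_p(α₁ α₂⁻¹ + α₂ ^ ((2 ς_ν - 1) / ρ_ν))`. -/
lemma isBigOp_regularization_bias
    (hass : RateAssumption P x y z A B μ g ν h c ρμ ρν ςμ ςν γμ γν m)
    {α₁ α₂ : ℕ → ℝ} (hα₁ : ∀ T, 0 < α₁ T) (hα₂ : ∀ T, 0 < α₂ T)
    (hreg : ∀ᶠ T : ℕ in atTop, (T : ℝ)⁻¹ ≤ α₁ T)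
    (μh : ℕ → Ω → ℕ → ℝ) (gh : ℕ → Ω → HilbertBasis ℕ ℝ H)
    (hzz : ∀ T ω, IsEigensystem (sampleOp z z T ω) (μh T ω) (gh T ω))
    (νh : ℕ → Ω → ℕ → ℝ) (hh : ℕ → Ω → HilbertBasis ℕ ℝ H)
    (hQ : ∀ T ω, IsEigensystem (sampleQ x z α₁ μh gh T ω) (νh T ω) (hh T ω)) :
    IsBigOp P
      (fun T ω => ‖A ∘L (ContinuousLinearMap.id ℝ H - projTilde α₂ νh hh T ω)‖ₑ ^ 2)
      (fun T => α₁ T * (α₂ T)⁻¹ + (α₂ T) ^ ((2 * ςν - 1) / ρν)) := by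
  have hb := hass.toBasicAssumption
  have hρν := hass.hρν
  have hςν := hass.hςν
  have hsμ := summable_of_decay (fun j => (hb.pos_μ j).le) hass.hρμ hass.decay_μ
  have hsν := summable_of_decay (fun j => (hb.pos_ν j).le) hρν hass.decay_ν
  have hpop := hb.popQ_eq hsμ
  obtain ⟨C, hC0, hC⟩ := exists_norm_comp_compl_firstProj_sq_le A h hass.hγν hςν hass.smooth_A
  have hlow := lower_bound_of_gap (inv_pos.2 hass.c_pos) (by linarith : 0 < ρν)
    (fun j => sq_nonneg (ν j)) hass.gap_ν
  set κ : ℝ := c⁻¹ * 2 ^ (-ρν - 1) with hκ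
  have hκ0 : 0 < κ := by have := hass.c_pos; positivity
  set E : ℝ := (4 / κ) ^ ((2 * ςν - 1) / ρν) with hE
  have hE0 : 0 ≤ E := by positivity
  -- The population cutoff is `4 * a` because `√(4 α₂) = 2 √α₂`, the separation that the projection
  -- bound needs. With indices from 0, `K` is the first discarded index, so `ν K ^ 2 ≤ 4 * a`; the
  -- lower bound on `ν K ^ 2` then forces `K` to be large.
  have htail : ∀ a : ℝ, 0 < a → ‖A ∘L (ContinuousLinearMap.id ℝ H -
      firstProj h (truncCount ν (4 * a)))‖ ^ 2 ≤ C * E * a ^ ((2 * ςν - 1) / ρν) := by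
    intro a ha
    refine (hC _).trans ?_
    rw [mul_assoc C]
    refine mul_le_mul_of_nonneg_left ?_ hC0
    set K := truncCount ν (4 * a) with hK
    have h1 : ν K ^ 2 ≤ 4 * a := not_lt.1 fun hlt => lt_irrefl K
      ((lt_truncCount_iff hb.strictAnti_ν.antitone hsν.tendsto_atTop_zero (by positivity) K).2 hlt)
    have h2 : ((K : ℝ) + 1) ^ (-ρν) ≤ 4 / κ * a := by
      rw [div_mul_eq_mul_div, le_div_iff₀ hκ0, mul_comm]
      exact (hlow K).trans h1
    have h3 := Real.rpow_le_rpow (by positivity) h2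
      (div_nonneg (by linarith) (by linarith) : 0 ≤ (2 * ςν - 1) / ρν)
    rw [← Real.rpow_mul (by positivity), Real.mul_rpow (by positivity) ha.le] at h3
    rwa [show -ρν * ((2 * ςν - 1) / ρν) = 1 - 2 * ςν by field_simp; ring] at h3
  refine hb.rate_zz.mono_of_forall hb.rate_vz (fun T => by positivity) (fun T => by positivity)
    fun M hM => ?_
  -- The value of the first-stage bound divided by `s = √α₁`, when both moment errors are at most `M
  -- * s` and the cutoff is `s`.
  set L : ℝ := ‖B‖ ^ 2 * (M + 1) + 2 * ‖B‖ * M + M ^ 2 with hL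
  refine ⟨2 * ‖A‖ ^ 2 * L ^ 2 + 2 * C * E, ?_⟩
  filter_upwards [hreg] with T hT ω hω₁ hω₂
  refine enorm_sq_le_ofReal ?_
  set s := √(α₁ T) with hs
  set t := √(α₂ T) with ht
  have hs0 : 0 < s := Real.sqrt_pos.2 (hα₁ T)
  have ht0 : 0 < t := Real.sqrt_pos.2 (hα₂ T)
  have hTs : (T : ℝ) ^ (-(1 / 2) : ℝ) ≤ s :=
    Real.le_sqrt_of_sq_le (by rw [rpow_neg_half_sq]; exact hT)
  have hD : ‖sampleOp z z T ω - momentOp P (z 0) (z 0)‖ ≤ M * s :=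
    (norm_le_of_hsNorm_le g (by positivity) hω₁).trans (by gcongr)
  have hV : ‖sampleOp (resid B z x) z T ω‖ ≤ M * s :=
    (norm_le_of_hsNorm_le g (by positivity) hω₂).trans (by gcongr)
  obtain ⟨hμ1, hμ2⟩ := truncCount_bounds (hzz T ω).antitone
    ((hzz T ω).tendsto_zero (sampleOp_tendsto_zero _ _ _ _ _)) (hα₁ T)
  obtain ⟨-, hν2⟩ := truncCount_bounds (hQ T ω).antitone
    ((hQ T ω).tendsto_zero (sampleQ_tendsto_zero _ _ _ _ _ _ _ _)) (hα₂ T)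
  have hΔ : ‖sampleQ x z α₁ μh gh T ω - popQ (momentOp P (x 0) (z 0)) μ g‖ ≤ s * L := by
    rw [hpop, sampleQ, sampleOp_eq_comp_adjoint_add B z x z T ω]
    refine (norm_sub_first_stage_le (hzz T ω) (sampleOp_adjoint z z T ω) hs0 hμ1 hμ2).trans ?_
    calc _ ≤ ‖B‖ ^ 2 * (M * s + s) + 2 * ‖B‖ * (M * s) + (M * s) ^ 2 * s⁻¹ := by gcongr
      _ = s * L := by rw [hL]; field_simp
  obtain ⟨hK, -⟩ := truncCount_bounds hb.strictAnti_ν.antitone hsν.tendsto_atTop_zero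
    (by have := hα₂ T; positivity : 0 < 4 * α₂ T)
  have hsq4 : √(4 * α₂ T) = 2 * t := by
    rw [Real.sqrt_mul (by norm_num), show (4 : ℝ) = 2 ^ 2 by norm_num,
      Real.sqrt_sq (by norm_num)]
  rw [hsq4] at hK
  have hmain := norm_comp_compl_firstProj_le hb.eigen_Q (hQ T ω) ht0 hK hν2 A
  have hmain' : ‖A ∘L (ContinuousLinearMap.id ℝ H - projTilde α₂ νh hh T ω)‖ ≤
      ‖A‖ * (s * L / t) +
        ‖A ∘L (ContinuousLinearMap.id ℝ H - firstProj h (truncCount ν (4 * α₂ T)))‖ :=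
    hmain.trans (by gcongr)
  have hq : 0 ≤ (α₂ T) ^ ((2 * ςν - 1) / ρν) := Real.rpow_nonneg (hα₂ T).le _
  have hq' : 0 ≤ α₁ T * (α₂ T)⁻¹ := by have := hα₁ T; have := hα₂ T; positivity
  have hst : (s * L / t) ^ 2 = L ^ 2 * (α₁ T * (α₂ T)⁻¹) := by
    rw [div_pow, mul_pow, Real.sq_sqrt (hα₁ T).le, Real.sq_sqrt (hα₂ T).le]
    field_simp
  calc _ ≤ _ := pow_le_pow_left₀ (norm_nonneg _) hmain' 2
    _ ≤ 2 * ((‖A‖ * (s * L / t)) ^ 2 +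
        ‖A ∘L (ContinuousLinearMap.id ℝ H - firstProj h (truncCount ν (4 * α₂ T)))‖ ^ 2) :=
      add_sq_le
    _ ≤ 2 * (‖A‖ ^ 2 * (L ^ 2 * (α₁ T * (α₂ T)⁻¹)) +
        C * E * (α₂ T) ^ ((2 * ςν - 1) / ρν)) := by
      rw [mul_pow, hst]
      gcongr
      exact htail _ (hα₂ T)
    _ ≤ _ := by
      have h1 : 0 ≤ C * E * (α₁ T * (α₂ T)⁻¹) := by positivity
      have h2 : 0 ≤ ‖A‖ ^ 2 * L ^ 2 * (α₂ T) ^ ((2 * ςν - 1) / ρν) := by positivity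
      linarith

end Main

end FIV

theorem theorem7 {H : Type*} [NormedAddCommGroup H] [InnerProductSpace ℝ H] [CompleteSpace H]
    [SecondCountableTopology H] [MeasurableSpace H] [BorelSpace H]
    {Ω : Type*} [MeasurableSpace Ω] (P : Measure Ω) [IsProbabilityMeasure P]
    (x y z : ℕ → Ω → H) (A B : H →L[ℝ] H)
    (μ : ℕ → ℝ) (g : HilbertBasis ℕ ℝ H) (ν : ℕ → ℝ) (h : HilbertBasis ℕ ℝ H)
    (c ρμ ρν ςμ ςν γμ γν m : ℝ)
    (hass : FIV.RateAssumption P x y z A B μ g ν h c ρμ ρν ςμ ςν γμ γν m)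
    -- the regularization parameters
    (α₁ α₂ : ℕ → ℝ) (hα₁_pos : ∀ T, 0 < α₁ T) (hα₂_pos : ∀ T, 0 < α₂ T)
    (hα₁_lim : Tendsto α₁ atTop (𝓝 0)) (hα₂_lim : Tendsto α₂ atTop (𝓝 0))
    (hα₁_rate : (fun T : ℕ => (α₁ T)⁻¹) =o[atTop] fun T : ℕ => (T : ℝ) ^ (ρμ / (2 * ρμ + 2)))
    (hα₂_rate : (fun T : ℕ => (α₂ T)⁻¹) =o[atTop] fun T : ℕ => (α₁ T) ^ (-ρν / (2 * ρν + 2)))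
    -- the eigenelements of the sample operators
    (μh : ℕ → Ω → ℕ → ℝ) (gh : ℕ → Ω → HilbertBasis ℕ ℝ H)
    (hzz : ∀ T ω, FIV.IsEigensystem (FIV.sampleOp z z T ω) (μh T ω) (gh T ω))
    (νh : ℕ → Ω → ℕ → ℝ) (hh : ℕ → Ω → HilbertBasis ℕ ℝ H)
    (hQ : ∀ T ω, FIV.IsEigensystem (FIV.sampleQ x z α₁ μh gh T ω) (νh T ω) (hh T ω)) :
    FIV.IsBigOp P
      (fun T ω => ‖FIV.f2slse x y z α₁ α₂ μh gh νh hh T ω -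
        A ∘L FIV.projTilde α₂ νh hh T ω‖ₑ ^ 2)
      (fun T => (T : ℝ)⁻¹ * (α₁ T) ^ (-(1 / 2) : ℝ) * (α₂ T) ^ (-(1 / 2) : ℝ)) ∧
    FIV.IsBigOp P
      (fun T ω => ‖A ∘L (ContinuousLinearMap.id ℝ H - FIV.projTilde α₂ νh hh T ω)‖ₑ ^ 2)
      (fun T => α₁ T * (α₂ T)⁻¹ * max 1 ((α₂ T) ^ ((2 * ςν - 3) / ρν)) +
        (α₂ T) ^ ((2 * ςν - 1) / ρν)) ∧
    TendstoInMeasure P (FIV.f2slse x y z α₁ α₂ μh gh νh hh) atTop (fun _ => A) := by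
  have hρμ := hass.hρμ
  have hρν := hass.hρν
  have hςν := hass.hςν
  have hreg := FIV.eventually_regularization_bounds (by linarith : 0 < ρμ) (by linarith : 0 < ρν)
    hα₁_pos hα₂_pos hα₁_lim hα₁_rate hα₂_rate
  have hreg' : ∀ᶠ T : ℕ in atTop, (T : ℝ)⁻¹ ≤ α₁ T := by
    filter_upwards [hreg] with T hT
    have := hα₁_pos T
    nlinarith [hT.1, hT.2.1]
  have part1 := FIV.isBigOp_stochastic_error hass.toBasicAssumption hα₁_pos hα₂_pos μh gh hzz νh hh
    hQ
  have part2 := FIV.isBigOp_regularization_bias hass hα₁_pos hα₂_pos hreg' μh gh hzz νh hh hQ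
  have hr₁ : ∀ T : ℕ, 0 ≤ (T : ℝ)⁻¹ * (α₁ T) ^ (-(1 / 2) : ℝ) * (α₂ T) ^ (-(1 / 2) : ℝ) := by
    intro T
    have := hα₁_pos T
    have := hα₂_pos T
    positivity
  have hr₂ : ∀ T : ℕ, 0 ≤ α₁ T * (α₂ T)⁻¹ + (α₂ T) ^ ((2 * ςν - 1) / ρν) := by
    intro T
    have := hα₁_pos T
    have := hα₂_pos T
    positivity
  refine ⟨part1, ?_, ?_⟩
  -- The maximum is at least 1, so inserting it only enlarges the rate.
  · refine part2.mono_of_forall part2 hr₂ hr₂ fun M hM => ⟨M, Eventually.of_forall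
      fun T ω h1 _ => h1.trans (ENNReal.ofReal_le_ofReal ?_)⟩
    have := hα₁_pos T
    have := hα₂_pos T
    refine mul_le_mul_of_nonneg_left ?_ hM
    gcongr ?_ + _
    exact le_mul_of_one_le_right (by positivity) (le_max_left _ _)
  · have hsum : FIV.IsBigOp P (fun T ω => ‖FIV.f2slse x y z α₁ α₂ μh gh νh hh T ω - A‖ₑ ^ 2)
        (fun T => (T : ℝ)⁻¹ * (α₁ T) ^ (-(1 / 2) : ℝ) * (α₂ T) ^ (-(1 / 2) : ℝ) +
          (α₁ T * (α₂ T)⁻¹ + (α₂ T) ^ ((2 * ςν - 1) / ρν))) := by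
      -- The factor 2 is that of `(a + b)² ≤ 2 (a² + b²)`.
      refine part1.mono_of_forall part2 hr₁ hr₂ fun M hM => ⟨2 * M, Eventually.of_forall
        fun T ω h1 h2 => FIV.enorm_sq_le_ofReal ?_⟩
      rw [← ofReal_norm, ← ENNReal.ofReal_pow (norm_nonneg _),
        ENNReal.ofReal_le_ofReal_iff (mul_nonneg hM (hr₁ T))] at h1
      rw [← ofReal_norm, ← ENNReal.ofReal_pow (norm_nonneg _),
        ENNReal.ofReal_le_ofReal_iff (mul_nonneg hM (hr₂ T))] at h2
      have h3 : FIV.f2slse x y z α₁ α₂ μh gh νh hh T ω - A =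
          (FIV.f2slse x y z α₁ α₂ μh gh νh hh T ω - A ∘L FIV.projTilde α₂ νh hh T ω) -
            A ∘L (ContinuousLinearMap.id ℝ H - FIV.projTilde α₂ νh hh T ω) := by
        rw [ContinuousLinearMap.comp_sub, ContinuousLinearMap.comp_id]
        abel
      rw [h3]
      have h4 := pow_le_pow_left₀ (norm_nonneg _) (norm_sub_le
        (FIV.f2slse x y z α₁ α₂ μh gh νh hh T ω - A ∘L FIV.projTilde α₂ νh hh T ω)
        (A ∘L (ContinuousLinearMap.id ℝ H - FIV.projTilde α₂ νh hh T ω))) 2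
      refine (h4.trans add_sq_le).trans ?_
      linarith
    refine hsum.tendstoInMeasure ?_
    have hlim₁ : Tendsto (fun T : ℕ =>
        (T : ℝ)⁻¹ * (α₁ T) ^ (-(1 / 2) : ℝ) * (α₂ T) ^ (-(1 / 2) : ℝ)) atTop (𝓝 0) := by
      refine squeeze_zero' (Eventually.of_forall hr₁) ?_ hα₁_lim
      filter_upwards [hreg, hα₂_lim.eventually (ge_mem_nhds one_pos)] with T ⟨h1, h2, h3⟩ h4
      have p1 := hα₁_pos T
      have p2 := hα₂_pos T
      -- Replacing `α₂` by the smaller `α₁` turns the two inverse roots into `α₁⁻¹`, and `1/T ≤ α₁²`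
      -- leaves `α₁`.
      have h5 : α₁ T ≤ α₂ T := h3.trans (by nlinarith)
      rw [FIV.rpow_neg_half_eq p1, FIV.rpow_neg_half_eq p2]
      calc (T : ℝ)⁻¹ * (√(α₁ T))⁻¹ * (√(α₂ T))⁻¹
          ≤ α₁ T ^ 2 * (√(α₁ T))⁻¹ * (√(α₁ T))⁻¹ := by gcongr
        _ = α₁ T ^ 2 * (√(α₁ T) * √(α₁ T))⁻¹ := by rw [mul_inv]; ring
        _ = α₁ T := by rw [Real.mul_self_sqrt p1.le]; field_simp
    have hlim₂ : Tendsto (fun T : ℕ => α₁ T * (α₂ T)⁻¹) atTop (𝓝 0) := by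
      refine squeeze_zero' (Eventually.of_forall fun T => ?_) ?_ hα₂_lim
      · have := hα₁_pos T
        have := hα₂_pos T
        positivity
      · filter_upwards [hreg] with T hT
        have p2 := hα₂_pos T
        rw [← div_eq_mul_inv, div_le_iff₀ p2, ← sq]
        exact hT.2.2
    have hlim₃ : Tendsto (fun T : ℕ => (α₂ T) ^ ((2 * ςν - 1) / ρν)) atTop (𝓝 0) := by
      have he : 0 < (2 * ςν - 1) / ρν := div_pos (by linarith) (by linarith)
      have := hα₂_lim.rpow_const (p := (2 * ςν - 1) / ρν) (Or.inr he.le)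
      rwa [Real.zero_rpow he.ne'] at this
    simpa using hlim₁.add (hlim₂.add hlim₃)
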